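/- Let $0<2\alpha<1$ and $0<2\beta<1$. For $x,y>0$ and $x_0,y_0\ge 0$ with $(x,y)\ne(x_0,y_0)$ put $$q_4(x,y;x_0,y_0)=k_4\,(r^2)^{\alpha+\beta-2}x^{1-2\alpha}y^{1-2\beta}x_0^{1-2\alpha}y_0^{1-2\beta}\,F_2(2-\alpha-\beta;1-\alpha,1-\beta;2-2\alpha,2-2\beta;\xi,\eta),$$ $$k_4=\frac{2^{4-2\alpha-2\beta}\,\Gamma(1-\alpha)\Gamma(1-\beta)\Gamma(2-\alpha-\beta)}{4\pi\,\Gamma(2-2\alpha)\Gamma(2-2\beta)},\qquad \xi=\frac{r^2-r_1^2}{r^2},\quad \eta=\frac{r^2-r_2^2}{r^2},$$ where $r^2=(x-x_0)^2+(y-y_0)^2$, $r_1^2=(x+x_0)^2+(y-y_0)^2$, $r_2^2=(x-x_0)^2+(y+y_0)^2$, and $F_2$ is Appell's function $$F_2(a;b_1,b_2;c_1,c_2;X,Y)=\sum_{m,n\ge 0}\frac{(a)_{m+n}(b_1)_m(b_2)_n}{(c_1)_m(c_2)_n\,m!\,n!}X^mY^n\qquad(|X|+|Y|<1),$$ continued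 analytically to $X<1$, $Y<1$, $X+Y<1$ by Euler's double integral. Let $a,b,l>0$ and let $\Gamma$ be a simple plane curve $x=x(s)$, $y=y(s)$, $s\in[0,l]$, parametrized by arc length, from $B=(0,b)$ ($s=0$) to $A=(a,0)$ ($s=l$), with $x(s),y(s)>0$ for $0<s<l$, such that: 1. $x(s),y(s)$ are twice continuously differentiable on $[0,l]$, their first derivatives do not vanish simultaneously, and their second derivatives are Hölder continuous on $[0,l]$; 2. for some constants $C$ and $0<\varepsilon<1$, in neighbourhoods of the points $A$ and $B$ on $\Gamma$, $$\left|\frac{dx}{ds}\right|\le C\,y(s)^{1+\varepsilon},\qquad \left|\frac{dy}{ds}\right|\le C\,x(s)^{1+\varepsilon}.$$ Let $\dfrac{\partial}{\partial n}=\dfrac{dy}{ds}\dfrac{\partial}{\partial x}-\dfrac{dx}{ds}\dfrac{\partial}{\partial y}$ be the normal derivative along $\Gamma$ at $(x,y)=(x(s),y(s))$. Then there is a constant $C_1$, depending only on $\alpha$, $\beta$ and $\Gamma$, such that for all $(x_0,y_0)$ with $x_0\ge 0$, $y_0\ge 0$ (including points of $\Gamma$) the following integral converges absolutely and $$\int_\Gamma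 x^{2\alpha}y^{2\beta}\left|\frac{\partial q_4(x,y;x_0,y_0)}{\partial n}\right|ds\le C_1 .$$ -/

import Mathlib

namespace FourthPotential

section AppellFunction

open MeasureTheory Set

theorem pochhammer_hasSum (a : ℝ) {z : ℝ} (hz : |z| < 1) :
    HasSum (fun k : ℕ => (ascPochhammer ℝ k).eval a / (k.factorial : ℝ) * z ^ k)
      ((1 - z) ^ (-a)) := by
  have h := (Real.one_div_one_sub_rpow_hasFPowerSeriesOnBall_zero a).hasSum
    (y := z) (by simpa [enorm_eq_nnnorm, ← NNReal.coe_lt_coe] using hz)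
  have h1 : (0 : ℝ) ≤ 1 - z := by have := abs_lt.1 hz; linarith
  simp only [zero_add, one_div, ← Real.rpow_neg h1] at h
  have e : (fun k : ℕ => (ascPochhammer ℝ k).eval a / (k.factorial : ℝ) * z ^ k) = fun k =>
      FormalMultilinearSeries.ofScalars ℝ (fun n : ℕ => Ring.choose (a + n - 1) n) k
        fun _ => z := by
    funext k
    rw [FormalMultilinearSeries.ofScalars_apply_eq, smul_eq_mul]
    congr 1
    have hk : (k.factorial : ℝ) ≠ 0 := by positivity
    rw [div_eq_iff hk, mul_comm, ← nsmul_eq_mul, Ring.choose]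
    have := Ring.factorial_nsmul_multichoose_eq_ascPochhammer (a : ℝ) k
    rw [Polynomial.ascPochhammer_smeval_eq_eval] at this
    rw [← this]
    congr 2
    ring
  rw [e]
  exact h

theorem antidiag_sum (C : ℝ) (X Y : ℝ) (k : ℕ) :
    ∑ p ∈ Finset.HasAntidiagonal.antidiagonal k, C / ((p.1.factorial : ℝ) * (p.2.factorial : ℝ)) * X ^ p.1 * Y ^ p.2
      = C / (k.factorial : ℝ) * (X + Y) ^ k := by
  rw [Commute.add_pow' (Commute.all X Y), Finset.mul_sum]
  refine Finset.sum_congr rfl fun p hp => ?_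
  have hp' := Finset.HasAntidiagonal.mem_antidiagonal.1 hp
  subst hp'
  rw [nsmul_eq_mul, show (p.1 + p.2).choose p.1 = (p.1 + p.2).factorial / (p.1.factorial * p.2.factorial) by
    rw [Nat.choose_symm_add, Nat.add_choose], Nat.cast_div (Nat.factorial_mul_factorial_dvd_factorial_add _ _)
    (by positivity)]
  push_cast
  have h1 : (p.1.factorial : ℝ) ≠ 0 := by positivity
  have h2 : (p.2.factorial : ℝ) ≠ 0 := by positivity
  have h3 : ((p.1 + p.2).factorial : ℝ) ≠ 0 := by positivity
  field_simp

theorem double_summable (a : ℝ) {X Y : ℝ} (h : |X| + |Y| < 1) :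
    Summable (fun p : ℕ × ℕ => |(ascPochhammer ℝ (p.1 + p.2)).eval a| /
      ((p.1.factorial : ℝ) * (p.2.factorial : ℝ)) * |X| ^ p.1 * |Y| ^ p.2) := by
  rw [← Finset.HasAntidiagonal.sigmaAntidiagonalEquivProd.summable_iff,
    summable_sigma_of_nonneg (fun p => by simp only [Function.comp]; positivity)]
  refine ⟨fun k => (hasSum_fintype _).summable, ?_⟩
  have hs := (pochhammer_hasSum a (z := |X| + |Y|)
    (by rwa [abs_of_nonneg (by positivity)])).summable.abs
  refine hs.congr fun k => ?_
  rw [tsum_fintype, abs_mul, abs_div, abs_of_nonneg (a := (|X| + |Y|) ^ k) (by positivity),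
    abs_of_nonneg (a := (k.factorial : ℝ)) (by positivity), ← antidiag_sum]
  rw [← Finset.sum_coe_sort (Finset.HasAntidiagonal.antidiagonal k)]
  refine Finset.sum_congr rfl fun p _ => ?_
  have := Finset.HasAntidiagonal.mem_antidiagonal.1 p.2
  simp [Finset.HasAntidiagonal.sigmaAntidiagonalEquivProd, this]

theorem double_hasSum (a : ℝ) {X Y : ℝ} (h : |X| + |Y| < 1) :
    HasSum (fun p : ℕ × ℕ => (ascPochhammer ℝ (p.1 + p.2)).eval a /
      ((p.1.factorial : ℝ) * (p.2.factorial : ℝ)) * X ^ p.1 * Y ^ p.2) ((1 - X - Y) ^ (-a)) := by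
  have hs : Summable (fun p : ℕ × ℕ => (ascPochhammer ℝ (p.1 + p.2)).eval a /
      ((p.1.factorial : ℝ) * (p.2.factorial : ℝ)) * X ^ p.1 * Y ^ p.2) := by
    refine Summable.of_abs ((double_summable a h).congr fun p => ?_)
    simp [abs_mul, abs_div, abs_pow]
  rw [← Finset.HasAntidiagonal.sigmaAntidiagonalEquivProd.hasSum_iff]
  rw [show 1 - X - Y = 1 - (X + Y) by ring]
  refine HasSum.sigma_of_hasSum
    (pochhammer_hasSum a (lt_of_le_of_lt (abs_add_le X Y) h)) (fun k => ?_)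
    (Finset.HasAntidiagonal.sigmaAntidiagonalEquivProd.summable_iff.2 hs)
  have e := hasSum_fintype fun c : Finset.HasAntidiagonal.antidiagonal k =>
    ((fun p : ℕ × ℕ => (ascPochhammer ℝ (p.1 + p.2)).eval a /
      ((p.1.factorial : ℝ) * (p.2.factorial : ℝ)) * X ^ p.1 * Y ^ p.2) ∘
        Finset.HasAntidiagonal.sigmaAntidiagonalEquivProd) ⟨k, c⟩
  have e' : (ascPochhammer ℝ k).eval a / (k.factorial : ℝ) * (X + Y) ^ k =
      ∑ c : Finset.HasAntidiagonal.antidiagonal k,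
      ((fun p : ℕ × ℕ => (ascPochhammer ℝ (p.1 + p.2)).eval a /
      ((p.1.factorial : ℝ) * (p.2.factorial : ℝ)) * X ^ p.1 * Y ^ p.2) ∘
        Finset.HasAntidiagonal.sigmaAntidiagonalEquivProd) ⟨k, c⟩ := by
    rw [← antidiag_sum, ← Finset.sum_coe_sort (Finset.HasAntidiagonal.antidiagonal k)]
    refine Finset.sum_congr rfl fun p _ => ?_
    have := Finset.HasAntidiagonal.mem_antidiagonal.1 p.2
    simp [Finset.HasAntidiagonal.sigmaAntidiagonalEquivProd, this]
  rw [e']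
  exact e

theorem beta_integrable {b d : ℝ} (hb : 0 < b) (hd : 0 < d) :
    IntegrableOn (fun u : ℝ => u ^ (b - 1) * (1 - u) ^ (d - 1)) (Ioo 0 1) := by
  have h := Complex.betaIntegral_convergent (u := (b : ℂ)) (v := (d : ℂ)) (by simpa) (by simpa)
  rw [intervalIntegrable_iff_integrableOn_Ioo_of_le zero_le_one] at h
  refine h.norm.congr ?_
  filter_upwards [ae_restrict_mem measurableSet_Ioo] with u hu
  rw [norm_mul, ← Complex.ofReal_one, ← Complex.ofReal_sub, ← Complex.ofReal_sub,
    ← Complex.ofReal_sub, Complex.norm_cpow_eq_rpow_re_of_pos hu.1,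
    Complex.norm_cpow_eq_rpow_re_of_pos (sub_pos.2 hu.2)]
  simp

theorem beta_integral {b d : ℝ} (hb : 0 < b) (hd : 0 < d) :
    ∫ u in Ioo (0 : ℝ) 1, u ^ (b - 1) * (1 - u) ^ (d - 1)
      = Real.Gamma b * Real.Gamma d / Real.Gamma (b + d) := by
  have h := Complex.betaIntegral_eq_Gamma_mul_div (u := (b : ℂ)) (v := (d : ℂ))
    (by simpa) (by simpa)
  rw [Complex.betaIntegral, intervalIntegral.integral_of_le zero_le_one,
    integral_Ioc_eq_integral_Ioo] at h
  rw [← Complex.ofReal_inj]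
  push_cast
  rw [← Complex.Gamma_ofReal, ← Complex.Gamma_ofReal, ← Complex.Gamma_ofReal]
  push_cast
  rw [← h, ← integral_complex_ofReal]
  refine setIntegral_congr_fun measurableSet_Ioo fun u hu => ?_
  rw [Complex.ofReal_mul, Complex.ofReal_cpow hu.1.le, Complex.ofReal_cpow (sub_pos.2 hu.2).le]
  push_cast
  rfl

theorem gamma_pochhammer {b : ℝ} (hb : 0 < b) (n : ℕ) :
    Real.Gamma (b + n) = (ascPochhammer ℝ n).eval b * Real.Gamma b := by
  induction n with
  | zero => simp
  | succ n ih =>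
    rw [Nat.cast_succ, ← add_assoc, Real.Gamma_add_one (by positivity), ih,
      ascPochhammer_succ_eval]
    ring

/-- Appell's double series
`F₂(a; b₁, b₂; c₁, c₂; x, y) = ∑ (a)_{m+n} (b₁)_m (b₂)_n / ((c₁)_m (c₂)_n m! n!) x^m y^n`,
which converges for `|x| + |y| < 1`. -/
noncomputable def appellF2Series (a b₁ b₂ c₁ c₂ x y : ℝ) : ℝ :=
  ∑' p : ℕ × ℕ,
    (ascPochhammer ℝ (p.1 + p.2)).eval a * (ascPochhammer ℝ p.1).eval b₁ *
        (ascPochhammer ℝ p.2).eval b₂ /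
      ((ascPochhammer ℝ p.1).eval c₁ * (ascPochhammer ℝ p.2).eval c₂ *
        (p.1.factorial : ℝ) * (p.2.factorial : ℝ)) * x ^ p.1 * y ^ p.2

/-- Appell's function `F₂(a; b₁, b₂; c₁, c₂; x, y)` for `0 < bᵢ < cᵢ`, on the whole region
`x < 1, y < 1, x + y < 1`, given by Euler's double integral. This is the analytic continuation of
the double series to that region; the theorem `appellF2_eq_series` below proves that the two agree
wherever the series converges. The continuation is needed because the arguments `ξ, η ≤ 0` of the
fundamental solution are unbounded near its singularity. -/
noncomputable def appellF2 (a b₁ b₂ c₁ c₂ x y : ℝ) : ℝ :=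
  Real.Gamma c₁ * Real.Gamma c₂ /
      (Real.Gamma b₁ * Real.Gamma (c₁ - b₁) * (Real.Gamma b₂ * Real.Gamma (c₂ - b₂))) *
    ∫ p in Ioo (0 : ℝ) 1 ×ˢ Ioo (0 : ℝ) 1,
      p.1 ^ (b₁ - 1) * (1 - p.1) ^ (c₁ - b₁ - 1) *
        (p.2 ^ (b₂ - 1) * (1 - p.2) ^ (c₂ - b₂ - 1)) *
        (1 - p.1 * x - p.2 * y) ^ (-a)

theorem beta_moment {b c : ℝ} (hb : 0 < b) (hc : b < c) (m : ℕ) :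
    IntegrableOn (fun u : ℝ => u ^ (b - 1) * (1 - u) ^ (c - b - 1) * u ^ m) (Ioo 0 1) ∧
    ∫ u in Ioo (0 : ℝ) 1, u ^ (b - 1) * (1 - u) ^ (c - b - 1) * u ^ m
      = (ascPochhammer ℝ m).eval b / (ascPochhammer ℝ m).eval c *
        (Real.Gamma b * Real.Gamma (c - b) / Real.Gamma c) := by
  have hm : 0 < b + m := by positivity
  have hd : 0 < c - b := sub_pos.2 hc
  have hc0 : 0 < c := hb.trans hc
  have e : EqOn (fun u : ℝ => u ^ (b + m - 1) * (1 - u) ^ (c - b - 1))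
      (fun u : ℝ => u ^ (b - 1) * (1 - u) ^ (c - b - 1) * u ^ m) (Ioo 0 1) := by
    intro u hu
    have : u ^ (b + m - 1) = u ^ (b - 1) * u ^ m := by
      rw [show b + m - 1 = b - 1 + m by ring, Real.rpow_add hu.1, Real.rpow_natCast]
    simp only [this]
    ring
  refine ⟨(beta_integrable hm hd).congr_fun e measurableSet_Ioo, ?_⟩
  rw [← setIntegral_congr_fun measurableSet_Ioo e, beta_integral hm hd,
    show b + m + (c - b) = c + m by ring, gamma_pochhammer hb, gamma_pochhammer hc0]
  have := (ascPochhammer_pos m c hc0).ne'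
  have := (Real.Gamma_pos_of_pos hc0).ne'
  field_simp

/-- Euler's integral agrees with the double series where the latter converges. -/
theorem appellF2_eq_series {a b₁ b₂ c₁ c₂ x y : ℝ} (hb₁ : 0 < b₁) (hc₁ : b₁ < c₁)
    (hb₂ : 0 < b₂) (hc₂ : b₂ < c₂) (hxy : |x| + |y| < 1) :
    appellF2 a b₁ b₂ c₁ c₂ x y = appellF2Series a b₁ b₂ c₁ c₂ x y := by
  set w₁ : ℝ → ℝ := fun u => u ^ (b₁ - 1) * (1 - u) ^ (c₁ - b₁ - 1) with hw₁
  set w₂ : ℝ → ℝ := fun u => u ^ (b₂ - 1) * (1 - u) ^ (c₂ - b₂ - 1) with hw₂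
  set K : ℕ × ℕ → ℝ := fun q => (ascPochhammer ℝ (q.1 + q.2)).eval a /
      ((q.1.factorial : ℝ) * (q.2.factorial : ℝ)) * x ^ q.1 * y ^ q.2 with hK
  set F : ℕ × ℕ → ℝ × ℝ → ℝ := fun q p =>
    K q * ((w₁ p.1 * p.1 ^ q.1) * (w₂ p.2 * p.2 ^ q.2)) with hF
  set μ : Measure (ℝ × ℝ) := volume.restrict (Ioo (0 : ℝ) 1 ×ˢ Ioo (0 : ℝ) 1) with hμ
  have hμ' : μ = (volume.restrict (Ioo (0 : ℝ) 1)).prod (volume.restrict (Ioo (0 : ℝ) 1)) := by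
    rw [hμ, Measure.volume_eq_prod, Measure.prod_restrict]
  have hint : ∀ q, Integrable (F q) μ := by
    intro q
    rw [hμ']
    exact ((beta_moment hb₁ hc₁ q.1).1.mul_prod (beta_moment hb₂ hc₂ q.2).1).const_mul _
  have hval : ∀ q, ∫ p, F q p ∂μ = K q * ((∫ u in Ioo (0 : ℝ) 1, w₁ u * u ^ q.1) *
      ∫ u in Ioo (0 : ℝ) 1, w₂ u * u ^ q.2) := by
    intro q
    rw [hμ', integral_const_mul, integral_prod_mul (fun u => w₁ u * u ^ q.1)
      (fun u => w₂ u * u ^ q.2)]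
  have hnn : ∀ {b c u : ℝ}, u ∈ Ioo (0 : ℝ) 1 → 0 ≤ u ^ (b - 1) * (1 - u) ^ (c - b - 1) :=
    fun hu => mul_nonneg (Real.rpow_nonneg hu.1.le _) (Real.rpow_nonneg (sub_nonneg.2 hu.2.le) _)
  have hmem : ∀ᵐ p ∂μ, p ∈ Ioo (0 : ℝ) 1 ×ˢ Ioo (0 : ℝ) 1 :=
    ae_restrict_mem (measurableSet_Ioo.prod measurableSet_Ioo)
  have hKs : Summable fun q => |K q| := by
    refine (double_summable a hxy).congr fun q => ?_
    simp [hK, abs_mul, abs_div, abs_pow]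
  have hsum : Summable fun q => ∫ p, ‖F q p‖ ∂μ := by
    refine Summable.of_nonneg_of_le (fun q => integral_nonneg fun p => norm_nonneg _) (fun q => ?_)
      (hKs.mul_right (∫ p, ‖w₁ p.1 * p.1 ^ 0 * (w₂ p.2 * p.2 ^ 0)‖ ∂μ))
    rw [← integral_const_mul]
    have h0 : Integrable (fun p : ℝ × ℝ => w₁ p.1 * p.1 ^ 0 * (w₂ p.2 * p.2 ^ 0)) μ := by
      rw [hμ']
      exact (beta_moment hb₁ hc₁ 0).1.mul_prod (beta_moment hb₂ hc₂ 0).1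
    refine integral_mono_ae (hint q).norm (h0.norm.const_mul _) ?_
    filter_upwards [hmem] with p hp
    have h1 : p.1 ^ q.1 ≤ 1 := pow_le_one₀ hp.1.1.le hp.1.2.le
    have h2 : p.2 ^ q.2 ≤ 1 := pow_le_one₀ hp.2.1.le hp.2.2.le
    have h3 : 0 ≤ p.1 ^ q.1 := pow_nonneg hp.1.1.le _
    have h4 : 0 ≤ p.2 ^ q.2 := pow_nonneg hp.2.1.le _
    simp only [hF, norm_mul, Real.norm_eq_abs, pow_zero, mul_one, abs_of_nonneg h3,
      abs_of_nonneg h4]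
    gcongr
    · exact mul_le_of_le_one_right (abs_nonneg _) h1
    · exact mul_le_of_le_one_right (abs_nonneg _) h2
  have key := hasSum_integral_of_summable_integral_norm hint hsum
  have hpt : ∫ p, (∑' q, F q p) ∂μ = ∫ p in Ioo (0 : ℝ) 1 ×ˢ Ioo (0 : ℝ) 1,
      p.1 ^ (b₁ - 1) * (1 - p.1) ^ (c₁ - b₁ - 1) *
        (p.2 ^ (b₂ - 1) * (1 - p.2) ^ (c₂ - b₂ - 1)) *
        (1 - p.1 * x - p.2 * y) ^ (-a) := by
    refine integral_congr_ae ?_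
    filter_upwards [hmem] with p hp
    have hb : |p.1 * x| + |p.2 * y| < 1 := by
      rw [abs_mul, abs_mul, abs_of_pos hp.1.1, abs_of_pos hp.2.1]
      have := mul_le_of_le_one_left (abs_nonneg x) hp.1.2.le
      have := mul_le_of_le_one_left (abs_nonneg y) hp.2.2.le
      linarith
    have := (double_hasSum a hb).mul_left (w₁ p.1 * w₂ p.2)
    rw [← this.tsum_eq]
    refine tsum_congr fun q => ?_
    simp only [hF, hK, mul_pow]
    ring
  have hΓ : ∀ {t : ℝ}, 0 < t → Real.Gamma t ≠ 0 := fun h => (Real.Gamma_pos_of_pos h).ne'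
  rw [appellF2, ← hpt, ← key.tsum_eq, appellF2Series, ← tsum_mul_left]
  refine tsum_congr fun q => ?_
  rw [hval, (beta_moment hb₁ hc₁ q.1).2, (beta_moment hb₂ hc₂ q.2).2]
  have e1 := hΓ hb₁
  have e2 := hΓ hb₂
  have e3 := hΓ (sub_pos.2 hc₁)
  have e4 := hΓ (sub_pos.2 hc₂)
  have e5 := hΓ (hb₁.trans hc₁)
  have e6 := hΓ (hb₂.trans hc₂)
  have e7 := (ascPochhammer_pos q.1 c₁ (hb₁.trans hc₁)).ne'
  have e8 := (ascPochhammer_pos q.2 c₂ (hb₂.trans hc₂)).ne'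
  simp only [hK]
  field_simp

end AppellFunction

/-- The normalising constant `k₄`. -/
noncomputable def k4 (α β : ℝ) : ℝ :=
  2 ^ (4 - 2 * α - 2 * β) * Real.Gamma (1 - α) * Real.Gamma (1 - β) * Real.Gamma (2 - α - β) /
    (4 * Real.pi * Real.Gamma (2 - 2 * α) * Real.Gamma (2 - 2 * β))

/-- `r² = (x - x₀)² + (y - y₀)²`. -/
def rSq (x y x₀ y₀ : ℝ) : ℝ := (x - x₀) ^ 2 + (y - y₀) ^ 2

/-- `r₁² = (x + x₀)² + (y - y₀)²`. -/
def r1Sq (x y x₀ y₀ : ℝ) : ℝ := (x + x₀) ^ 2 + (y - y₀) ^ 2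

/-- `r₂² = (x - x₀)² + (y + y₀)²`. -/
def r2Sq (x y x₀ y₀ : ℝ) : ℝ := (x - x₀) ^ 2 + (y + y₀) ^ 2

/-- `ξ = (r² - r₁²) / r²`. -/
noncomputable def xi (x y x₀ y₀ : ℝ) : ℝ :=
  (rSq x y x₀ y₀ - r1Sq x y x₀ y₀) / rSq x y x₀ y₀

/-- `η = (r² - r₂²) / r²`. -/
noncomputable def eta (x y x₀ y₀ : ℝ) : ℝ :=
  (rSq x y x₀ y₀ - r2Sq x y x₀ y₀) / rSq x y x₀ y₀

/-- The fourth fundamental solution `q₄(x, y; x₀, y₀)` of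
`u_xx + u_yy + (2α/x) u_x + (2β/y) u_y = 0` (meaningful off the diagonal `r = 0`). -/
noncomputable def q4 (α β x y x₀ y₀ : ℝ) : ℝ :=
  k4 α β * rSq x y x₀ y₀ ^ (α + β - 2) *
    x ^ (1 - 2 * α) * y ^ (1 - 2 * β) * x₀ ^ (1 - 2 * α) * y₀ ^ (1 - 2 * β) *
    appellF2 (2 - α - β) (1 - α) (1 - β) (2 - 2 * α) (2 - 2 * β)
      (xi x y x₀ y₀) (eta x y x₀ y₀)

/-- Derivative at arc length `s` of a coordinate function on `[0, l]` (one-sided at the ends). -/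
noncomputable def dds (l : ℝ) (f : ℝ → ℝ) (s : ℝ) : ℝ := derivWithin f (Set.Icc 0 l) s

/-- The normal derivative `∂q₄/∂n = (dy/ds) ∂q₄/∂x - (dx/ds) ∂q₄/∂y` at the point `(x(s), y(s))`
of the curve, the differentiation being with respect to the first pair of variables. -/
noncomputable def normalDerivQ4 (α β l : ℝ) (x y : ℝ → ℝ) (x₀ y₀ s : ℝ) : ℝ :=
  dds l y s * deriv (fun t => q4 α β t (y s) x₀ y₀) (x s) -
    dds l x s * deriv (fun t => q4 α β (x s) t x₀ y₀) (y s)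

/-- The standing assumptions on the curve `Γ : s ↦ (x(s), y(s))`, `s ∈ [0, l]`. -/
structure IsAdmissibleCurve (a b l : ℝ) (x y : ℝ → ℝ) : Prop where
  a_pos : 0 < a
  b_pos : 0 < b
  l_pos : 0 < l
  /-- `Γ` starts at `B(0, b)`. -/
  start_eq : x 0 = 0 ∧ y 0 = b
  /-- `Γ` ends at `A(a, 0)`. -/
  end_eq : x l = a ∧ y l = 0
  /-- Apart from its endpoints, `Γ` lies in the open first quadrant. -/
  quadrant : ∀ s ∈ Set.Ioo 0 l, 0 < x s ∧ 0 < y s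
  /-- `Γ` is a simple curve. -/
  simple : Set.InjOn (fun s => (x s, y s)) (Set.Icc 0 l)
  /-- `x` and `y` are twice continuously differentiable on `[0, l]`. -/
  contDiff_x : ContDiffOn ℝ 2 x (Set.Icc 0 l)
  contDiff_y : ContDiffOn ℝ 2 y (Set.Icc 0 l)
  /-- `s` is the arc length; in particular `x'` and `y'` do not vanish simultaneously. -/
  arcLength : ∀ s ∈ Set.Icc 0 l, dds l x s ^ 2 + dds l y s ^ 2 = 1
  /-- The second derivatives are Hölder continuous on `[0, l]`. -/
  holder_x : ∃ K γ : NNReal, 0 < γ ∧ γ ≤ 1 ∧ HolderOnWith K γ (dds l (dds l x)) (Set.Icc 0 l)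
  holder_y : ∃ K γ : NNReal, 0 < γ ∧ γ ≤ 1 ∧ HolderOnWith K γ (dds l (dds l y)) (Set.Icc 0 l)
  /-- Near both endpoints, `|dx/ds| ≤ C y^{1+ε}` and `|dy/ds| ≤ C x^{1+ε}`. -/
  endpoints : ∃ C ε δ : ℝ, 0 < ε ∧ ε < 1 ∧ 0 < δ ∧
    ∀ s ∈ Set.Icc 0 l, (s < δ ∨ l - δ < s) →
      |dds l x s| ≤ C * y s ^ (1 + ε) ∧ |dds l y s| ≤ C * x s ^ (1 + ε)

end FourthPotential

/-! Since `r₁² - r² = 4 x x₀` and `r₂² - r² = 4 y y₀`, Euler's integral absorbs the power of `r²`.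
Up to a constant, `q₄` is `W x^(1-2α) y^(1-2β) I`. Here `W = x₀^(1-2α) y₀^(1-2β)`, and `I` is the
integral over the unit square of a Beta weight times `D^(-(2-α-β))`, with `D = R + 4u x x₀ + 4v y
y₀` and `R = r²`.

Differentiation (`weighted_normal_deriv_q4_eq`) raises the exponent by one. One term is `W x y J N`,
where `J` carries the exponent `3-α-β` and `N` is the normal component of the vector from `(x₀, y₀)`
to the curve. The other terms contain `x'` or `y'` as a factor. The endpoint conditions give `|x'| ≤
L y` and `|y'| ≤ L x`, so these terms are of size `W x y I`.

Bounding `D` below in each variable separately gives `J ≤ C R⁻¹ (R + x x₀)^(-(1-α)) (R + y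
y₀)^(-(1-β))`. The bound for `I` is similar, with `R^(-1/4)` and slightly weaker decay. As `R + x
x₀` dominates `x²` and `x₀²`, and likewise in `y`, the factor `W x y` compensates this decay. Hence
the integrand is at most `C (|N| / R + 1 + R^(-1/4))` (`exists_weighted_normal_deriv_q4_le`): the
logarithmic double layer kernel plus a weak singularity.

The rest is geometry of a simple C² arc (`exists_double_layer_le`). If `s₀` is the parameter of a
point nearest to `(x₀, y₀)`, at distance `d`, then `|N| ≤ K (s - s₀)² + d`, while `R` dominates both
`d²` and `κ² (s - s₀)²`. So `|N| / R` is bounded by a constant plus a Poisson kernel, whose integral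
is at most `π / κ` up to a factor 2, whatever `d` and `s₀` are; and `R^(-1/4) ≤ (κ |s - s₀|)^(-1/2)`
is integrable uniformly in `s₀`. -/

namespace FourthPotential

open MeasureTheory Set Filter Topology

/-! ### One-variable integrals of the Beta weight against negative powers of `R + u A`. -/

section BetaWeight

/-- The symmetric Euler weight `(u (1 - u)) ^ (-α)` on the unit interval. -/
noncomputable def betaWeight (α u : ℝ) : ℝ := u ^ (-α) * (1 - u) ^ (-α)

theorem measurable_betaWeight (α : ℝ) : Measurable (betaWeight α) := by
  unfold betaWeight; fun_prop

theorem betaWeight_nonneg (α : ℝ) {u : ℝ} (hu : u ∈ Ioo (0 : ℝ) 1) : 0 ≤ betaWeight α u :=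
  mul_nonneg (Real.rpow_nonneg hu.1.le _) (Real.rpow_nonneg (sub_nonneg.2 hu.2.le) _)

theorem integrableOn_betaWeight {α : ℝ} (hα : α < 1) :
    IntegrableOn (betaWeight α) (Ioo 0 1) := by
  have h := beta_integrable (b := 1 - α) (d := 1 - α) (by linarith) (by linarith)
  rw [show 1 - α - 1 = -α by ring] at h
  exact h

theorem integrableOn_betaWeight_mul_rpow {α : ℝ} (hα : α < 1) {R A : ℝ} (hR : 0 < R)
    (hA : 0 ≤ A) {e : ℝ} (he : 0 ≤ e) :
    IntegrableOn (fun u => betaWeight α u * (R + u * A) ^ (-e)) (Ioo 0 1) := by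
  refine (integrableOn_betaWeight hα).mul_bdd (c := R ^ (-e))
    (Measurable.aestronglyMeasurable (by fun_prop)) ?_
  filter_upwards [ae_restrict_mem measurableSet_Ioo] with u hu
  have h0 : R ≤ R + u * A := le_add_of_nonneg_right (mul_nonneg hu.1.le hA)
  rw [Real.norm_of_nonneg (Real.rpow_nonneg (hR.le.trans h0) _)]
  exact Real.rpow_le_rpow_of_nonpos hR h0 (by linarith)

theorem mul_add_le_add_mul {R A u : ℝ} (hR : 0 ≤ R) (hu : u ≤ 1) : u * (R + A) ≤ R + u * A := by
  nlinarith

/-- From `R + u A ≥ u (R + A)`, what remains under the integral is `u^(θ-1) (1-u)^(-α)`, integrable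
exactly because `θ > 0`. At `θ = 0` a logarithm would appear. -/
theorem exists_integral_betaWeight_mul_rpow_le {α θ : ℝ} (hα : α < 1) (hθ : 0 < θ)
    (hθ' : θ ≤ 1 - α) :
    ∃ C, 0 ≤ C ∧ ∀ R A : ℝ, 0 < R → 0 ≤ A →
      ∫ u in Ioo (0 : ℝ) 1, betaWeight α u * (R + u * A) ^ (-(1 - α - θ)) ≤
        C * (R + A) ^ (-(1 - α - θ)) := by
  refine ⟨∫ u in Ioo (0 : ℝ) 1, u ^ (θ - 1) * (1 - u) ^ (-α), ?_, fun R A hR hA => ?_⟩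
  · exact setIntegral_nonneg measurableSet_Ioo fun u hu =>
      mul_nonneg (Real.rpow_nonneg hu.1.le _) (Real.rpow_nonneg (sub_nonneg.2 hu.2.le) _)
  have hint : IntegrableOn (fun u : ℝ => u ^ (θ - 1) * (1 - u) ^ (-α)) (Ioo 0 1) := by
    simpa only [show 1 - α - 1 = -α by ring] using
      beta_integrable (b := θ) (d := 1 - α) hθ (by linarith)
  rw [← integral_mul_const]
  refine setIntegral_mono_on (integrableOn_betaWeight_mul_rpow hα hR hA (by linarith))
    (hint.mul_const _) measurableSet_Ioo fun u hu => ?_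
  have h1 : (R + u * A) ^ (-(1 - α - θ)) ≤ u ^ (-(1 - α - θ)) * (R + A) ^ (-(1 - α - θ)) := by
    rw [← Real.mul_rpow hu.1.le (by positivity)]
    exact Real.rpow_le_rpow_of_nonpos (mul_pos hu.1 (by positivity))
      (mul_add_le_add_mul hR.le hu.2.le) (by linarith)
  calc betaWeight α u * (R + u * A) ^ (-(1 - α - θ))
      ≤ betaWeight α u * (u ^ (-(1 - α - θ)) * (R + A) ^ (-(1 - α - θ))) :=
        mul_le_mul_of_nonneg_left h1 (betaWeight_nonneg α hu)
    _ = u ^ (θ - 1) * (1 - u) ^ (-α) * (R + A) ^ (-(1 - α - θ)) := by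
        rw [show θ - 1 = -α + -(1 - α - θ) by ring, Real.rpow_add hu.1, betaWeight]
        ring

/-- The bound `R + u A ≥ u (R + A)` alone would leave the non-integrable `u^(-3/2)`. It is therefore
used only for `u ≥ T = R / (R + A)`, the crossover where `R = u (R + A)`; below `T` the bound `R + u
A ≥ R` is better. -/
theorem integral_rpow_split_le {α R A : ℝ} (hα : 0 ≤ α) (hα' : α < 1) (hR : 0 < R)
    (hA : 0 ≤ A) :
    ∫ u in (0 : ℝ)..1, betaWeight α u * (R + u * A) ^ (-(3 / 2 - α)) ≤
      (2 ^ (3 / 2 - α) * (∫ u in (0 : ℝ)..1, betaWeight α u) + 2 ^ α * (1 / (1 - α) + 2)) *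
        (R ^ (-(1 / 2) : ℝ) * (R + A) ^ (-(1 - α))) := by
  set e : ℝ := 3 / 2 - α with he
  have he0 : 0 < e := by rw [he]; linarith
  set S := R + A with hS
  have hS0 : 0 < S := by positivity
  set B := R ^ (-(1 / 2) : ℝ) * S ^ (-(1 - α)) with hB
  set T := R / S with hT
  have hT0 : 0 < T := by positivity
  have hT1 : T ≤ 1 := (div_le_one hS0).2 (by rw [hS]; linarith)
  have hw : IntervalIntegrable (betaWeight α) volume 0 1 := by
    rw [intervalIntegrable_iff_integrableOn_Ioo_of_le zero_le_one]
    exact integrableOn_betaWeight hα'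
  have hF : IntervalIntegrable (fun u => betaWeight α u * (R + u * A) ^ (-e)) volume 0 1 := by
    rw [intervalIntegrable_iff_integrableOn_Ioo_of_le zero_le_one]
    exact integrableOn_betaWeight_mul_rpow hα' hR hA he0.le
  have m1 : uIcc 0 T ⊆ uIcc (0 : ℝ) 1 := by
    rw [uIcc_of_le hT0.le, uIcc_of_le zero_le_one]; exact Icc_subset_Icc_right hT1
  have m2 : uIcc T 1 ⊆ uIcc (0 : ℝ) 1 := by
    rw [uIcc_of_le hT1, uIcc_of_le zero_le_one]; exact Icc_subset_Icc_left hT0.le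
  -- pointwise bound, given a bound of the kernel on the half near the origin
  have key : ∀ u ∈ Ioo (0 : ℝ) 1, ∀ G : ℝ, 0 ≤ G → (R + u * A) ^ (-e) ≤ G →
      betaWeight α u * (R + u * A) ^ (-e) ≤
        2 ^ e * B * betaWeight α u + 2 ^ α * (u ^ (-α) * G) := by
    intro u hu G hG hle
    have hu0 := hu.1
    have hu1 : 0 < 1 - u := sub_pos.2 hu.2
    have hwu := betaWeight_nonneg α hu
    -- For `u ≤ 1/2` the singularity of the weight at 1 is harmless; for `u ≥ 1/2` the kernel is
    -- already at most `(S / 2)^(-e)`, which is at most `2^e B`.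
    rcases le_total u (1 / 2) with h | h
    · have h1 : (1 - u) ^ (-α) ≤ 2 ^ α := by
        rw [Real.rpow_neg hu1.le, ← Real.inv_rpow hu1.le]
        refine Real.rpow_le_rpow (by positivity) ?_ hα
        rw [inv_le_comm₀ hu1 (by norm_num)]; linarith
      have h2 : betaWeight α u ≤ u ^ (-α) * 2 ^ α :=
        mul_le_mul_of_nonneg_left h1 (Real.rpow_nonneg hu0.le _)
      have h3 : betaWeight α u * (R + u * A) ^ (-e) ≤ u ^ (-α) * 2 ^ α * G :=
        mul_le_mul h2 hle (Real.rpow_nonneg (by positivity) _) (by positivity)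
      have h4 : 0 ≤ 2 ^ e * B * betaWeight α u := by positivity
      linarith
    · have h1 : (R + u * A) ^ (-e) ≤ 2 ^ e * B := by
        have h2 : (R + u * A) ^ (-e) ≤ (S / 2) ^ (-e) :=
          Real.rpow_le_rpow_of_nonpos (by positivity) (by rw [hS]; nlinarith) (by linarith)
        have h3 : (S / 2) ^ (-e) = 2 ^ e * (S ^ (-(1 / 2) : ℝ) * S ^ (-(1 - α))) := by
          rw [← Real.rpow_add hS0, Real.div_rpow hS0.le (by norm_num),
            Real.rpow_neg (by norm_num : (0 : ℝ) ≤ 2), div_inv_eq_mul, mul_comm]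
          congr 2; rw [he]; ring
        have h4 : S ^ (-(1 / 2) : ℝ) ≤ R ^ (-(1 / 2) : ℝ) :=
          Real.rpow_le_rpow_of_nonpos hR (by rw [hS]; linarith) (by norm_num)
        rw [h3] at h2
        refine h2.trans ?_
        rw [hB]; gcongr
      have h5 := mul_le_mul_of_nonneg_left h1 hwu
      have h6 : 0 ≤ 2 ^ α * (u ^ (-α) * G) := by positivity
      linarith
  have p1 : IntervalIntegrable (fun u : ℝ => u ^ (-α)) volume 0 T :=
    intervalIntegral.intervalIntegrable_rpow' (by linarith)
  have n0 : (0 : ℝ) ∉ uIcc T 1 := by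
    rw [uIcc_of_le hT1]; exact fun h => absurd h.1 (not_le.2 hT0)
  have p2 : IntervalIntegrable (fun u : ℝ => u ^ (-(3 / 2) : ℝ)) volume T 1 :=
    intervalIntegral.intervalIntegrable_rpow (Or.inr n0)
  have b1 : ∫ u in (0 : ℝ)..T, betaWeight α u * (R + u * A) ^ (-e) ≤
      ∫ u in (0 : ℝ)..T, (2 ^ e * B * betaWeight α u + 2 ^ α * R ^ (-e) * u ^ (-α)) := by
    refine intervalIntegral.integral_mono_on_of_le_Ioo hT0.le (hF.mono_set m1)
      (((hw.mono_set m1).const_mul _).add (p1.const_mul _)) fun u hu => ?_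
    have := key u ⟨hu.1, hu.2.trans_le hT1⟩ (R ^ (-e)) (by positivity)
      (Real.rpow_le_rpow_of_nonpos hR
        (le_add_of_nonneg_right (mul_nonneg hu.1.le hA)) (by linarith))
    linarith
  have b2 : ∫ u in T..1, betaWeight α u * (R + u * A) ^ (-e) ≤
      ∫ u in T..1, (2 ^ e * B * betaWeight α u + 2 ^ α * S ^ (-e) * u ^ (-(3 / 2) : ℝ)) := by
    refine intervalIntegral.integral_mono_on_of_le_Ioo hT1 (hF.mono_set m2)
      (((hw.mono_set m2).const_mul _).add (p2.const_mul _)) fun u hu => ?_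
    have hu0 : 0 < u := hT0.trans hu.1
    have := key u ⟨hu0, hu.2⟩ ((u * S) ^ (-e)) (by positivity)
      (Real.rpow_le_rpow_of_nonpos (by positivity)
        (mul_add_le_add_mul hR.le hu.2.le) (by linarith))
    rw [Real.mul_rpow hu0.le hS0.le, ← mul_assoc (u ^ (-α)), ← Real.rpow_add hu0,
      show -α + -e = -(3 / 2) by rw [he]; ring] at this
    linarith
  rw [intervalIntegral.integral_add ((hw.mono_set m1).const_mul _) (p1.const_mul _),
    intervalIntegral.integral_const_mul, intervalIntegral.integral_const_mul,
    integral_rpow (Or.inl (by linarith)), Real.zero_rpow (by linarith)] at b1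
  rw [intervalIntegral.integral_add ((hw.mono_set m2).const_mul _) (p2.const_mul _),
    intervalIntegral.integral_const_mul, intervalIntegral.integral_const_mul,
    integral_rpow (Or.inr ⟨by norm_num, n0⟩), Real.one_rpow] at b2
  -- The choice of `T` makes both sides of the split contribute the same quantity `B`.
  have e1 : R ^ (-e) * T ^ (-α + 1) = B := by
    rw [hT, Real.div_rpow hR.le hS0.le, hB, ← mul_div_assoc, ← Real.rpow_add hR,
      Real.rpow_neg hS0.le, div_eq_mul_inv]
    congr 2
    · rw [he]; ring
    · congr 1; ring
  have e2 : S ^ (-e) * T ^ (-(3 / 2) + 1 : ℝ) = B := by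
    rw [hT, Real.div_rpow hR.le hS0.le, hB, div_eq_mul_inv, ← Real.rpow_neg hS0.le,
      mul_comm, mul_assoc, ← Real.rpow_add hS0]
    congr 2
    · norm_num
    · rw [he]; ring
  have s1 := intervalIntegral.integral_add_adjacent_intervals (hF.mono_set m1) (hF.mono_set m2)
  have s2 := intervalIntegral.integral_add_adjacent_intervals (hw.mono_set m1) (hw.mono_set m2)
  rw [← s1, ← s2]
  have f1 : 2 ^ α * R ^ (-e) * ((T ^ (-α + 1) - 0) / (-α + 1)) = 2 ^ α * (B * (1 / (1 - α))) := by
    rw [← e1]; rw [show -α + 1 = 1 - α by ring]; ring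
  have f2 : 2 ^ α * S ^ (-e) * ((1 - T ^ (-(3 / 2) + 1 : ℝ)) / (-(3 / 2) + 1)) ≤
      2 ^ α * (B * 2) := by
    rw [← e2]
    have : 0 ≤ 2 ^ α * S ^ (-e) := by positivity
    calc _ = 2 ^ α * S ^ (-e) * (2 * T ^ (-(3 / 2) + 1 : ℝ) - 2) := by ring
      _ ≤ 2 ^ α * S ^ (-e) * (2 * T ^ (-(3 / 2) + 1 : ℝ)) :=
          mul_le_mul_of_nonneg_left (by linarith) this
      _ = _ := by ring
  rw [f1] at b1
  nlinarith [b1, b2, f2]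

theorem exists_integral_betaWeight_mul_rpow_le_sqrt {α : ℝ} (hα : 0 ≤ α) (hα' : α < 1) :
    ∃ C, 0 ≤ C ∧ ∀ R A : ℝ, 0 < R → 0 ≤ A →
      ∫ u in Ioo (0 : ℝ) 1, betaWeight α u * (R + u * A) ^ (-(3 / 2 - α)) ≤
        C * (R ^ (-(1 / 2) : ℝ) * (R + A) ^ (-(1 - α))) := by
  refine ⟨2 ^ (3 / 2 - α) * (∫ u in (0 : ℝ)..1, betaWeight α u) + 2 ^ α * (1 / (1 - α) + 2),
    ?_, fun R A hR hA => ?_⟩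
  · have h1 : 0 ≤ ∫ u in (0 : ℝ)..1, betaWeight α u := by
      rw [intervalIntegral.integral_of_le zero_le_one, integral_Ioc_eq_integral_Ioo]
      exact setIntegral_nonneg measurableSet_Ioo fun u hu => betaWeight_nonneg α hu
    have : 0 < 1 - α := by linarith
    positivity
  · rw [← integral_Ioc_eq_integral_Ioo, ← intervalIntegral.integral_of_le zero_le_one]
    exact integral_rpow_split_le hα hα' hR hA

end BetaWeight

/-! ### Euler's double integral: decoupling of the two variables. -/

section DoubleIntegral

/-- The open unit square. -/
def unitSquare : Set (ℝ × ℝ) := Ioo (0 : ℝ) 1 ×ˢ Ioo (0 : ℝ) 1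

theorem measurableSet_unitSquare : MeasurableSet unitSquare :=
  measurableSet_Ioo.prod measurableSet_Ioo

/-- The product weight in Euler's double integral. -/
noncomputable def betaWeight₂ (α β : ℝ) (p : ℝ × ℝ) : ℝ := betaWeight α p.1 * betaWeight β p.2

theorem measurable_betaWeight₂ (α β : ℝ) : Measurable (betaWeight₂ α β) :=
  ((measurable_betaWeight α).comp measurable_fst).mul
    ((measurable_betaWeight β).comp measurable_snd)

theorem betaWeight₂_nonneg (α β : ℝ) {p : ℝ × ℝ} (hp : p ∈ unitSquare) :
    0 ≤ betaWeight₂ α β p :=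
  mul_nonneg (betaWeight_nonneg α hp.1) (betaWeight_nonneg β hp.2)

theorem integrableOn_mul_unitSquare {f g : ℝ → ℝ} (hf : IntegrableOn f (Ioo 0 1))
    (hg : IntegrableOn g (Ioo 0 1)) :
    IntegrableOn (fun p : ℝ × ℝ => f p.1 * g p.2) unitSquare := by
  rw [IntegrableOn, unitSquare, Measure.volume_eq_prod, ← Measure.prod_restrict]
  exact hf.mul_prod hg

theorem integrableOn_betaWeight₂ {α β : ℝ} (hα : α < 1) (hβ : β < 1) :
    IntegrableOn (betaWeight₂ α β) unitSquare :=
  integrableOn_mul_unitSquare (integrableOn_betaWeight hα) (integrableOn_betaWeight hβ)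

/-- The denominator `r² + 4 u x x₀ + 4 v y y₀` that Euler's integral produces. -/
def eulerDenom (R A B : ℝ) (p : ℝ × ℝ) : ℝ := R + 4 * p.1 * A + 4 * p.2 * B

theorem measurable_eulerDenom (R A B : ℝ) : Measurable (eulerDenom R A B) := by
  unfold eulerDenom; fun_prop

theorem le_eulerDenom {R A B : ℝ} (hA : 0 ≤ A) (hB : 0 ≤ B) {p : ℝ × ℝ} (hp : p ∈ unitSquare) :
    R ≤ eulerDenom R A B p := by
  have h1 : 0 ≤ p.1 * A := mul_nonneg hp.1.1.le hA
  have h2 : 0 ≤ p.2 * B := mul_nonneg hp.2.1.le hB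
  unfold eulerDenom; linarith

theorem add_mul_fst_le_eulerDenom {R A B : ℝ} (hA : 0 ≤ A) (hB : 0 ≤ B) {p : ℝ × ℝ}
    (hp : p ∈ unitSquare) : R + p.1 * A ≤ eulerDenom R A B p := by
  have h1 : 0 ≤ p.1 * A := mul_nonneg hp.1.1.le hA
  have h2 : 0 ≤ p.2 * B := mul_nonneg hp.2.1.le hB
  unfold eulerDenom; linarith

theorem add_mul_snd_le_eulerDenom {R A B : ℝ} (hA : 0 ≤ A) (hB : 0 ≤ B) {p : ℝ × ℝ}
    (hp : p ∈ unitSquare) : R + p.2 * B ≤ eulerDenom R A B p := by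
  have h1 : 0 ≤ p.1 * A := mul_nonneg hp.1.1.le hA
  have h2 : 0 ≤ p.2 * B := mul_nonneg hp.2.1.le hB
  unfold eulerDenom; linarith

theorem integrableOn_mul_eulerDenom_rpow {α β : ℝ} (hα : α < 1) (hβ : β < 1) {R A B e : ℝ}
    (hR : 0 < R) (hA : 0 ≤ A) (hB : 0 ≤ B) (he : 0 ≤ e) {c : ℝ × ℝ → ℝ} (hc : Measurable c)
    (hc1 : ∀ p ∈ unitSquare, |c p| ≤ 1) :
    IntegrableOn (fun p => betaWeight₂ α β p * (c p * eulerDenom R A B p ^ (-e))) unitSquare := by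
  refine (integrableOn_betaWeight₂ hα hβ).mul_bdd (c := R ^ (-e))
    (hc.mul ((measurable_eulerDenom R A B).pow_const _)).aestronglyMeasurable ?_
  filter_upwards [ae_restrict_mem measurableSet_unitSquare] with p hp
  have h0 := le_eulerDenom (R := R) hA hB hp
  have h1 : 0 ≤ eulerDenom R A B p ^ (-e) := Real.rpow_nonneg (hR.le.trans h0) _
  rw [norm_mul, Real.norm_of_nonneg h1, Real.norm_eq_abs]
  calc |c p| * eulerDenom R A B p ^ (-e) ≤ 1 * R ^ (-e) :=
        mul_le_mul (hc1 p hp) (Real.rpow_le_rpow_of_nonpos hR h0 (by linarith)) h1 zero_le_one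
    _ = _ := one_mul _

theorem integrableOn_eulerDenom_rpow {α β : ℝ} (hα : α < 1) (hβ : β < 1) {R A B e : ℝ}
    (hR : 0 < R) (hA : 0 ≤ A) (hB : 0 ≤ B) (he : 0 ≤ e) :
    IntegrableOn (fun p => betaWeight₂ α β p * eulerDenom R A B p ^ (-e)) unitSquare := by
  simpa only [one_mul] using integrableOn_mul_eulerDenom_rpow hα hβ hR hA hB he
    (c := fun _ => 1) measurable_const (by simp)

/-- `D` dominates each of `R`, `R + u A` and `R + v B`, so its power may be shared among the three,
and the double integral becomes a product. -/
theorem integral_eulerDenom_le_of_split {α β : ℝ} (hα : α < 1) (hβ : β < 1) {R A B e₀ e₁ e₂ : ℝ}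
    (hR : 0 < R) (hA : 0 ≤ A) (hB : 0 ≤ B) (h₀ : 0 ≤ e₀) (h₁ : 0 ≤ e₁) (h₂ : 0 ≤ e₂) :
    ∫ p in unitSquare, betaWeight₂ α β p * eulerDenom R A B p ^ (-(e₀ + e₁ + e₂)) ≤
      R ^ (-e₀) * ((∫ u in Ioo (0 : ℝ) 1, betaWeight α u * (R + u * A) ^ (-e₁)) *
        ∫ v in Ioo (0 : ℝ) 1, betaWeight β v * (R + v * B) ^ (-e₂)) := by
  have h := setIntegral_prod_mul (μ := (volume : Measure ℝ)) (ν := (volume : Measure ℝ))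
    (fun u => betaWeight α u * (R + u * A) ^ (-e₁))
    (fun v => betaWeight β v * (R + v * B) ^ (-e₂)) (Ioo 0 1) (Ioo 0 1)
  rw [← h, ← Measure.volume_eq_prod, ← integral_const_mul]
  refine setIntegral_mono_on ?_ ?_ measurableSet_unitSquare fun p hp => ?_
  · exact integrableOn_eulerDenom_rpow hα hβ hR hA hB (by positivity)
  · exact (integrableOn_mul_unitSquare (integrableOn_betaWeight_mul_rpow hα hR hA h₁)
      (integrableOn_betaWeight_mul_rpow hβ hR hB h₂)).const_mul _
  · have hD := hR.trans_le (le_eulerDenom (R := R) hA hB hp)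
    have q1 : 0 < R + p.1 * A := add_pos_of_pos_of_nonneg hR (mul_nonneg hp.1.1.le hA)
    have q2 : 0 < R + p.2 * B := add_pos_of_pos_of_nonneg hR (mul_nonneg hp.2.1.le hB)
    have hw := betaWeight₂_nonneg α β hp
    rw [show -(e₀ + e₁ + e₂) = -e₀ + -e₁ + -e₂ by ring, Real.rpow_add hD, Real.rpow_add hD]
    have i0 := Real.rpow_le_rpow_of_nonpos hR (le_eulerDenom (R := R) hA hB hp)
      (by linarith : -e₀ ≤ 0)
    have i1 := Real.rpow_le_rpow_of_nonpos q1 (add_mul_fst_le_eulerDenom (R := R) hA hB hp)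
      (by linarith : -e₁ ≤ 0)
    have i2 := Real.rpow_le_rpow_of_nonpos q2 (add_mul_snd_le_eulerDenom (R := R) hA hB hp)
      (by linarith : -e₂ ≤ 0)
    calc _ ≤ betaWeight₂ α β p * (R ^ (-e₀) * (R + p.1 * A) ^ (-e₁) * (R + p.2 * B) ^ (-e₂)) := by
          gcongr
      _ = _ := by rw [betaWeight₂]; ring

/-- The bound for the kernel itself, with a small power in place of the logarithm. -/
theorem exists_integral_eulerDenom_le {α β : ℝ} (hα : α < 1 / 2) (hβ : β < 1 / 2) :
    ∃ C, 0 ≤ C ∧ ∀ R A B : ℝ, 0 < R → 0 ≤ A → 0 ≤ B →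
      ∫ p in unitSquare, betaWeight₂ α β p * eulerDenom R A B p ^ (-(2 - α - β)) ≤
        C * (R ^ (-(1 / 4) : ℝ) *
          ((R + A) ^ (-(1 - α - 1 / 8)) * (R + B) ^ (-(1 - β - 1 / 8)))) := by
  obtain ⟨C₁, hC₁, h₁⟩ := exists_integral_betaWeight_mul_rpow_le (α := α) (θ := 1 / 8)
    (by linarith) (by norm_num) (by linarith)
  obtain ⟨C₂, hC₂, h₂⟩ := exists_integral_betaWeight_mul_rpow_le (α := β) (θ := 1 / 8)
    (by linarith) (by norm_num) (by linarith)
  refine ⟨C₁ * C₂, by positivity, fun R A B hR hA hB => ?_⟩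
  -- Each variable gives up 1/8 of its exponent to avoid the logarithm. The resulting `R^(-1/4) =
  -- r^(-1/2)` is still integrable along a curve.
  have h := integral_eulerDenom_le_of_split (α := α) (β := β) (e₀ := 1 / 4)
    (e₁ := 1 - α - 1 / 8) (e₂ := 1 - β - 1 / 8) (by linarith) (by linarith) hR hA hB
    (by norm_num) (by linarith) (by linarith)
  rw [show 1 / 4 + (1 - α - 1 / 8) + (1 - β - 1 / 8) = 2 - α - β by ring] at h
  refine h.trans ?_
  calc _ ≤ R ^ (-(1 / 4) : ℝ) * ((C₁ * (R + A) ^ (-(1 - α - 1 / 8))) *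
        (C₂ * (R + B) ^ (-(1 - β - 1 / 8)))) := by
        refine mul_le_mul_of_nonneg_left (mul_le_mul (h₁ R A hR hA) (h₂ R B hR hB) ?_ ?_) ?_
        · exact setIntegral_nonneg measurableSet_Ioo fun u hu =>
            mul_nonneg (betaWeight_nonneg _ hu)
              (Real.rpow_nonneg (add_nonneg hR.le (mul_nonneg hu.1.le hB)) _)
        · positivity
        · positivity
    _ = _ := by ring

/-- The bound for the differentiated kernel. -/
theorem exists_integral_eulerDenom_succ_le {α β : ℝ} (hα : 0 ≤ α) (hα' : α < 1) (hβ : 0 ≤ β)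
    (hβ' : β < 1) :
    ∃ C, 0 ≤ C ∧ ∀ R A B : ℝ, 0 < R → 0 ≤ A → 0 ≤ B →
      ∫ p in unitSquare, betaWeight₂ α β p * eulerDenom R A B p ^ (-(3 - α - β)) ≤
        C * (R⁻¹ * ((R + A) ^ (-(1 - α)) * (R + B) ^ (-(1 - β)))) := by
  obtain ⟨C₁, hC₁, h₁⟩ := exists_integral_betaWeight_mul_rpow_le_sqrt hα hα'
  obtain ⟨C₂, hC₂, h₂⟩ := exists_integral_betaWeight_mul_rpow_le_sqrt hβ hβ'
  refine ⟨C₁ * C₂, by positivity, fun R A B hR hA hB => ?_⟩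
  -- The extra unit in the exponent is shared equally: each variable costs `R^(-1/2)`, together
  -- `R⁻¹`.
  have h := integral_eulerDenom_le_of_split (α := α) (β := β) (e₀ := 0)
    (e₁ := 3 / 2 - α) (e₂ := 3 / 2 - β) hα' hβ' hR hA hB le_rfl (by linarith) (by linarith)
  rw [show 0 + (3 / 2 - α) + (3 / 2 - β) = 3 - α - β by ring, neg_zero, Real.rpow_zero,
    one_mul] at h
  refine h.trans ?_
  calc _ ≤ (C₁ * (R ^ (-(1 / 2) : ℝ) * (R + A) ^ (-(1 - α)))) *
        (C₂ * (R ^ (-(1 / 2) : ℝ) * (R + B) ^ (-(1 - β)))) := by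
        refine mul_le_mul (h₁ R A hR hA) (h₂ R B hR hB) ?_ (by positivity)
        exact setIntegral_nonneg measurableSet_Ioo fun u hu =>
            mul_nonneg (betaWeight_nonneg _ hu)
              (Real.rpow_nonneg (add_nonneg hR.le (mul_nonneg hu.1.le hB)) _)
    _ = C₁ * C₂ * (R ^ (-(1 / 2) : ℝ) * R ^ (-(1 / 2) : ℝ) *
          ((R + A) ^ (-(1 - α)) * (R + B) ^ (-(1 - β)))) := by ring
    _ = _ := by
        rw [← Real.rpow_add hR, show (-(1 / 2) + -(1 / 2) : ℝ) = -1 by norm_num,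
          Real.rpow_neg_one]

/-- An extra factor `c` with `c (R + S) ≤ D` gains `(R + S)⁻¹` in the differentiated kernel. -/
theorem integral_weighted_eulerDenom_succ_le {α β : ℝ} (hα : α < 1) (hβ : β < 1) {R A B S : ℝ}
    (hR : 0 < R) (hA : 0 ≤ A) (hB : 0 ≤ B) (hS : 0 < S) {c : ℝ × ℝ → ℝ} (hc : Measurable c)
    (hc0 : ∀ p ∈ unitSquare, 0 ≤ c p) (hc1 : ∀ p ∈ unitSquare, c p ≤ 1)
    (hcS : ∀ p ∈ unitSquare, c p * S ≤ eulerDenom R A B p) :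
    ∫ p in unitSquare, betaWeight₂ α β p * (c p * eulerDenom R A B p ^ (-(3 - α - β))) ≤
      S⁻¹ * ∫ p in unitSquare, betaWeight₂ α β p * eulerDenom R A B p ^ (-(2 - α - β)) := by
  rw [← integral_const_mul]
  refine setIntegral_mono_on ?_ ?_ measurableSet_unitSquare fun p hp => ?_
  · exact integrableOn_mul_eulerDenom_rpow hα hβ hR hA hB (by linarith) hc fun p hp => by
      rw [abs_of_nonneg (hc0 p hp)]; exact hc1 p hp
  · exact (integrableOn_eulerDenom_rpow hα hβ hR hA hB (by linarith)).const_mul _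
  · have hD := hR.trans_le (le_eulerDenom (R := R) hA hB hp)
    have h1 : eulerDenom R A B p ^ (-(2 - α - β)) =
        eulerDenom R A B p ^ (-(3 - α - β)) * eulerDenom R A B p := by
      rw [show -(2 - α - β) = -(3 - α - β) + 1 by ring, Real.rpow_add_one hD.ne']
    have h2 : c p ≤ S⁻¹ * eulerDenom R A B p := by
      rw [inv_mul_eq_div, le_div_iff₀ hS]; exact hcS p hp
    have h3 : 0 ≤ eulerDenom R A B p ^ (-(3 - α - β)) := by positivity
    have hw := betaWeight₂_nonneg α β hp
    rw [h1]
    calc _ ≤ betaWeight₂ α β p *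
          (S⁻¹ * eulerDenom R A B p * eulerDenom R A B p ^ (-(3 - α - β))) := by gcongr
      _ = _ := by ring

end DoubleIntegral

/-! ### Integral representation of `q4` and its first derivatives. -/

section Derivative

/-- Both partial derivatives come from this one statement, since `D` has this form in `x` (with `c =
u`) and in `y` (with `c = v`), the other variables being collected in `k` and `d`. -/
theorem hasDerivAt_integral_rpow_quadratic {X : Type*} [MeasurableSpace X] {μ : Measure X}
    {w c d : X → ℝ} (hw : Integrable w μ) (hc : Measurable c) (hd : Measurable d)
    (hcd : ∀ᵐ p ∂μ, 0 ≤ c p ∧ c p ≤ 1 ∧ 0 ≤ d p) {t t₀ k e : ℝ} (ht : 0 < t) (ht₀ : 0 ≤ t₀)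
    (hR : 0 < (t - t₀) ^ 2 + k) (he : 0 ≤ e) :
    HasDerivAt (fun τ => ∫ p, w p * ((τ - t₀) ^ 2 + k + 4 * c p * (τ * t₀) + d p) ^ (-e) ∂μ)
      (∫ p, w p * ((2 * (t - t₀) + 4 * c p * t₀) * (-e) *
        ((t - t₀) ^ 2 + k + 4 * c p * (t * t₀) + d p) ^ (-e - 1)) ∂μ) t := by
  set R := (t - t₀) ^ 2 + k with hRdef
  -- On this neighbourhood the base stays above `R / 2` and its derivative stays bounded, which
  -- provides the dominating function.
  set s : Set ℝ := {τ | 0 < τ ∧ τ < t + 1 ∧ R / 2 < (τ - t₀) ^ 2 + k} with hs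
  have hs_nhds : s ∈ 𝓝 t := by
    refine IsOpen.mem_nhds ?_ ⟨ht, by linarith, by linarith⟩
    exact (isOpen_lt continuous_const continuous_id).inter
      ((isOpen_lt continuous_id continuous_const).inter
        (isOpen_lt continuous_const
          (by fun_prop : Continuous fun τ : ℝ => (τ - t₀) ^ 2 + k)))
  have hbase : ∀ τ ∈ s, ∀ p, 0 ≤ c p ∧ c p ≤ 1 ∧ 0 ≤ d p →
      R / 2 ≤ (τ - t₀) ^ 2 + k + 4 * c p * (τ * t₀) + d p := by
    intro τ hτ p hp
    have := mul_nonneg hp.1 (mul_nonneg hτ.1.le ht₀)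
    linarith [hτ.2.2, hp.2.2]
  have hts : t ∈ s := mem_of_mem_nhds hs_nhds
  refine (hasDerivAt_integral_of_dominated_loc_of_deriv_le
    (F := fun τ p => w p * ((τ - t₀) ^ 2 + k + 4 * c p * (τ * t₀) + d p) ^ (-e))
    (F' := fun τ p => w p * ((2 * (τ - t₀) + 4 * c p * t₀) * (-e) *
        ((τ - t₀) ^ 2 + k + 4 * c p * (τ * t₀) + d p) ^ (-e - 1)))
    (bound := fun p => |w p| * ((2 * (t + 1 + t₀) + 4 * t₀) * e * (R / 2) ^ (-e - 1)))
    hs_nhds ?_ ?_ ?_ ?_ (hw.abs.mul_const _) ?_).2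
  · exact Eventually.of_forall fun τ => hw.aestronglyMeasurable.mul
      (Measurable.aestronglyMeasurable (by fun_prop))
  · refine hw.mul_bdd (c := (R / 2) ^ (-e)) (Measurable.aestronglyMeasurable (by fun_prop)) ?_
    filter_upwards [hcd] with p hp
    have h := hbase t hts p hp
    rw [Real.norm_of_nonneg (Real.rpow_nonneg (by linarith) _)]
    exact Real.rpow_le_rpow_of_nonpos (by linarith) h (by linarith)
  · exact hw.aestronglyMeasurable.mul (Measurable.aestronglyMeasurable (by fun_prop))
  · filter_upwards [hcd] with p hp τ hτ
    have h := hbase τ hτ p hp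
    have h0 : 0 ≤ ((τ - t₀) ^ 2 + k + 4 * c p * (τ * t₀) + d p) ^ (-e - 1) :=
      Real.rpow_nonneg (by linarith) _
    have h1 : ((τ - t₀) ^ 2 + k + 4 * c p * (τ * t₀) + d p) ^ (-e - 1) ≤ (R / 2) ^ (-e - 1) :=
      Real.rpow_le_rpow_of_nonpos (by linarith) h (by linarith)
    have h2 : |2 * (τ - t₀) + 4 * c p * t₀| ≤ 2 * (t + 1 + t₀) + 4 * t₀ := by
      have := mul_nonneg hp.1 ht₀
      have := mul_le_mul_of_nonneg_right hp.2.1 ht₀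
      rw [abs_le]; constructor <;> linarith [hτ.1, hτ.2.1]
    have h3 : 0 ≤ 2 * (t + 1 + t₀) + 4 * t₀ := (abs_nonneg _).trans h2
    rw [norm_mul, norm_mul, norm_mul, Real.norm_of_nonneg h0, norm_neg, Real.norm_of_nonneg he,
      Real.norm_eq_abs, Real.norm_eq_abs]
    gcongr
  · filter_upwards [hcd] with p hp τ hτ
    have h := hbase τ hτ p hp
    have h1 : HasDerivAt (fun τ => (τ - t₀) ^ 2 + k + 4 * c p * (τ * t₀) + d p)
        (2 * (τ - t₀) + 4 * c p * t₀) τ := by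
      have i1 := (((hasDerivAt_id τ).sub_const t₀).pow 2).add_const k
      have i2 := ((hasDerivAt_id τ).mul_const t₀).const_mul (4 * c p)
      have i3 := (i1.add i2).add_const (d p)
      refine (i3.congr_deriv ?_)
      simp
    exact (h1.rpow_const (Or.inl (by linarith))).const_mul (w p)

/-- Euler's double integral as a function of both points. -/
noncomputable def eulerIntegral (α β e : ℝ) (c : ℝ × ℝ → ℝ) (x y x₀ y₀ : ℝ) : ℝ :=
  ∫ p in unitSquare, betaWeight₂ α β p *
    (c p * eulerDenom (rSq x y x₀ y₀) (x * x₀) (y * y₀) p ^ (-e))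

theorem measurable_eulerIntegral (α β e : ℝ) {c : ℝ × ℝ → ℝ} (hc : Measurable c) (x₀ y₀ : ℝ) :
    Measurable fun P : ℝ × ℝ => eulerIntegral α β e c P.1 P.2 x₀ y₀ := by
  unfold eulerIntegral
  refine (StronglyMeasurable.integral_prod_right ?_).measurable
  refine Measurable.stronglyMeasurable ?_
  have hs : Measurable (Prod.snd : (ℝ × ℝ) × ℝ × ℝ → ℝ × ℝ) := measurable_snd
  have h1 := (measurable_betaWeight₂ α β).comp hs
  have h2 := hc.comp hs
  refine h1.mul (h2.mul (Measurable.pow_const ?_ _))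
  simp only [eulerDenom, rSq]
  fun_prop

theorem abs_fst_le_one {p : ℝ × ℝ} (hp : p ∈ unitSquare) : |p.1| ≤ 1 := by
  rw [abs_of_pos hp.1.1]; exact hp.1.2.le

theorem abs_snd_le_one {p : ℝ × ℝ} (hp : p ∈ unitSquare) : |p.2| ≤ 1 := by
  rw [abs_of_pos hp.2.1]; exact hp.2.2.le

variable {α β e x y x₀ y₀ : ℝ}

/-- The inner derivative of `D` is affine in the Euler variable, so the differentiated integral
splits into the one with weight 1 and the one with weight `u` or `v`. -/
theorem integral_linear_eulerDenom (hα : α < 1) (hβ : β < 1) (hx : 0 ≤ x) (hy : 0 ≤ y)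
    (hx₀ : 0 ≤ x₀) (hy₀ : 0 ≤ y₀) (hR : 0 < rSq x y x₀ y₀) (he : 0 ≤ e) {c : ℝ × ℝ → ℝ}
    (hc : Measurable c) (hc1 : ∀ p ∈ unitSquare, |c p| ≤ 1) (m n : ℝ) :
    ∫ p in unitSquare, betaWeight₂ α β p * ((2 * m + 4 * c p * n) * (-e) *
      eulerDenom (rSq x y x₀ y₀) (x * x₀) (y * y₀) p ^ (-e - 1)) =
    -e * (2 * m * eulerIntegral α β (e + 1) (fun _ => 1) x y x₀ y₀ +
      4 * n * eulerIntegral α β (e + 1) c x y x₀ y₀) := by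
  have hA := mul_nonneg hx hx₀
  have hB := mul_nonneg hy hy₀
  have i1 := integrableOn_mul_eulerDenom_rpow hα hβ hR hA hB (e := e + 1) (by positivity)
    (c := fun _ => 1) measurable_const (by simp)
  have i2 := integrableOn_mul_eulerDenom_rpow hα hβ hR hA hB (e := e + 1) (by positivity) hc hc1
  rw [eulerIntegral, eulerIntegral, ← integral_const_mul, ← integral_const_mul,
    ← integral_add (i1.const_mul _) (i2.const_mul _), ← integral_const_mul]
  refine integral_congr_ae (Eventually.of_forall fun p => ?_)
  simp only [show -(e + 1) = -e - 1 by ring]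
  ring

theorem hasDerivAt_eulerIntegral_fst (hα : α < 1) (hβ : β < 1) (hx : 0 < x) (hy : 0 ≤ y)
    (hx₀ : 0 ≤ x₀) (hy₀ : 0 ≤ y₀) (hR : 0 < rSq x y x₀ y₀) (he : 0 ≤ e) :
    HasDerivAt (fun t => eulerIntegral α β e (fun _ => 1) t y x₀ y₀)
      (-e * (2 * (x - x₀) * eulerIntegral α β (e + 1) (fun _ => 1) x y x₀ y₀ +
        4 * x₀ * eulerIntegral α β (e + 1) Prod.fst x y x₀ y₀)) x := by
  rw [← integral_linear_eulerDenom hα hβ hx.le hy hx₀ hy₀ hR he measurable_fst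
    fun p hp => abs_fst_le_one hp]
  have h := hasDerivAt_integral_rpow_quadratic (μ := volume.restrict unitSquare)
    (integrableOn_betaWeight₂ hα hβ) (c := Prod.fst) (d := fun p => 4 * p.2 * (y * y₀))
    measurable_fst (by fun_prop) ?_ hx hx₀ (k := (y - y₀) ^ 2) hR he
  · simpa only [eulerIntegral, eulerDenom, rSq, one_mul] using h
  · filter_upwards [ae_restrict_mem measurableSet_unitSquare] with p hp
    exact ⟨hp.1.1.le, hp.1.2.le,
      mul_nonneg (mul_nonneg (by norm_num) hp.2.1.le) (mul_nonneg hy hy₀)⟩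

theorem hasDerivAt_eulerIntegral_snd (hα : α < 1) (hβ : β < 1) (hx : 0 ≤ x) (hy : 0 < y)
    (hx₀ : 0 ≤ x₀) (hy₀ : 0 ≤ y₀) (hR : 0 < rSq x y x₀ y₀) (he : 0 ≤ e) :
    HasDerivAt (fun t => eulerIntegral α β e (fun _ => 1) x t x₀ y₀)
      (-e * (2 * (y - y₀) * eulerIntegral α β (e + 1) (fun _ => 1) x y x₀ y₀ +
        4 * y₀ * eulerIntegral α β (e + 1) Prod.snd x y x₀ y₀)) y := by
  rw [← integral_linear_eulerDenom hα hβ hx hy.le hx₀ hy₀ hR he measurable_snd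
    fun p hp => abs_snd_le_one hp]
  have h := hasDerivAt_integral_rpow_quadratic (μ := volume.restrict unitSquare)
    (integrableOn_betaWeight₂ hα hβ) (c := Prod.snd) (d := fun p => 4 * p.1 * (x * x₀))
    measurable_snd (by fun_prop) ?_ hy hy₀ (k := (x - x₀) ^ 2)
    (by rw [rSq] at hR; linarith) he
  · have e1 : ∀ (t : ℝ) (p : ℝ × ℝ), eulerDenom (rSq x t x₀ y₀) (x * x₀) (t * y₀) p =
        (t - y₀) ^ 2 + (x - x₀) ^ 2 + 4 * p.2 * (t * y₀) + 4 * p.1 * (x * x₀) := by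
      intro t p; rw [eulerDenom, rSq]; ring
    simpa only [eulerIntegral, e1, one_mul] using h
  · filter_upwards [ae_restrict_mem measurableSet_unitSquare] with p hp
    exact ⟨hp.2.1.le, hp.2.2.le,
      mul_nonneg (mul_nonneg (by norm_num) hp.1.1.le) (mul_nonneg hx hx₀)⟩

/-- The constant in front of Euler's integral in `q₄`. -/
noncomputable def q4Const (α β : ℝ) : ℝ :=
  k4 α β * (Real.Gamma (2 - 2 * α) * Real.Gamma (2 - 2 * β) /
    (Real.Gamma (1 - α) * Real.Gamma (2 - 2 * α - (1 - α)) *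
      (Real.Gamma (1 - β) * Real.Gamma (2 - 2 * β - (1 - β)))))

/-- `r² (1 - u ξ - v η) = D`, so the prefactor `(r²)^(α+β-2)` merges with the power in Euler's
integral. As `c = 2b` in both variables, the Euler weights are symmetric. -/
theorem q4_eq_eulerIntegral (hx : 0 ≤ x) (hy : 0 ≤ y) (hx₀ : 0 ≤ x₀) (hy₀ : 0 ≤ y₀)
    (hR : 0 < rSq x y x₀ y₀) :
    q4 α β x y x₀ y₀ = q4Const α β * (x₀ ^ (1 - 2 * α) * y₀ ^ (1 - 2 * β)) *
      (x ^ (1 - 2 * α) * y ^ (1 - 2 * β) *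
        eulerIntegral α β (2 - α - β) (fun _ => 1) x y x₀ y₀) := by
  have h : rSq x y x₀ y₀ ^ (α + β - 2) * (∫ p in Ioo (0 : ℝ) 1 ×ˢ Ioo (0 : ℝ) 1,
      p.1 ^ (1 - α - 1) * (1 - p.1) ^ (2 - 2 * α - (1 - α) - 1) *
        (p.2 ^ (1 - β - 1) * (1 - p.2) ^ (2 - 2 * β - (1 - β) - 1)) *
        (1 - p.1 * xi x y x₀ y₀ - p.2 * eta x y x₀ y₀) ^ (-(2 - α - β))) =
      eulerIntegral α β (2 - α - β) (fun _ => 1) x y x₀ y₀ := by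
    rw [eulerIntegral, ← integral_const_mul]
    refine setIntegral_congr_fun measurableSet_unitSquare fun p hp => ?_
    have hD : 1 - p.1 * xi x y x₀ y₀ - p.2 * eta x y x₀ y₀ =
        eulerDenom (rSq x y x₀ y₀) (x * x₀) (y * y₀) p / rSq x y x₀ y₀ := by
      rw [xi, eta, eq_div_iff hR.ne']
      field_simp
      simp only [eulerDenom, rSq, r1Sq, r2Sq]
      ring
    have hD0 := le_eulerDenom (R := rSq x y x₀ y₀) (mul_nonneg hx hx₀) (mul_nonneg hy hy₀) hp
    have hR' : rSq x y x₀ y₀ ^ (-(2 - α - β)) ≠ 0 := (Real.rpow_pos_of_pos hR _).ne'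
    simp only [hD, Real.div_rpow (hR.le.trans hD0) hR.le, betaWeight₂, betaWeight, one_mul,
      show α + β - 2 = -(2 - α - β) by ring, show 1 - α - 1 = -α by ring,
      show 1 - β - 1 = -β by ring, show 2 - 2 * α - (1 - α) - 1 = -α by ring,
      show 2 - 2 * β - (1 - β) - 1 = -β by ring]
    field_simp
  rw [← h, q4, appellF2, q4Const]
  ring

theorem continuous_rSq_fst (y x₀ y₀ : ℝ) : Continuous fun t => rSq t y x₀ y₀ := by
  unfold rSq; fun_prop

theorem continuous_rSq_snd (x x₀ y₀ : ℝ) : Continuous fun t => rSq x t x₀ y₀ := by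
  unfold rSq; fun_prop

theorem deriv_q4_fst (hα : α < 1) (hβ : β < 1) (hx : 0 < x) (hy : 0 ≤ y)
    (hx₀ : 0 ≤ x₀) (hy₀ : 0 ≤ y₀) (hR : 0 < rSq x y x₀ y₀) :
    deriv (fun t => q4 α β t y x₀ y₀) x =
      q4Const α β * (x₀ ^ (1 - 2 * α) * y₀ ^ (1 - 2 * β)) * y ^ (1 - 2 * β) *
        ((1 - 2 * α) * x ^ (-(2 * α)) * eulerIntegral α β (2 - α - β) (fun _ => 1) x y x₀ y₀ -
          (2 - α - β) * x ^ (1 - 2 * α) *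
            (2 * (x - x₀) * eulerIntegral α β (3 - α - β) (fun _ => 1) x y x₀ y₀ +
              4 * x₀ * eulerIntegral α β (3 - α - β) Prod.fst x y x₀ y₀)) := by
  have hev : (fun t => q4 α β t y x₀ y₀) =ᶠ[𝓝 x] fun t =>
      q4Const α β * (x₀ ^ (1 - 2 * α) * y₀ ^ (1 - 2 * β)) * y ^ (1 - 2 * β) *
        (t ^ (1 - 2 * α) * eulerIntegral α β (2 - α - β) (fun _ => 1) t y x₀ y₀) := by
    filter_upwards [lt_mem_nhds hx, (continuous_rSq_fst y x₀ y₀).continuousAt.eventually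
      (lt_mem_nhds hR)] with t ht hRt
    rw [q4_eq_eulerIntegral ht.le hy hx₀ hy₀ hRt]
    ring
  rw [hev.deriv_eq]
  have h1 := hasDerivAt_eulerIntegral_fst (e := 2 - α - β) hα hβ hx hy hx₀ hy₀ hR (by linarith)
  have h2 := Real.hasDerivAt_rpow_const (p := 1 - 2 * α) (Or.inl hx.ne')
  refine ((h2.fun_mul h1).const_mul _).deriv.trans ?_
  rw [show 2 - α - β + 1 = 3 - α - β by ring, show 1 - 2 * α - 1 = -(2 * α) by ring]
  ring

theorem deriv_q4_snd (hα : α < 1) (hβ : β < 1) (hx : 0 ≤ x) (hy : 0 < y)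
    (hx₀ : 0 ≤ x₀) (hy₀ : 0 ≤ y₀) (hR : 0 < rSq x y x₀ y₀) :
    deriv (fun t => q4 α β x t x₀ y₀) y =
      q4Const α β * (x₀ ^ (1 - 2 * α) * y₀ ^ (1 - 2 * β)) * x ^ (1 - 2 * α) *
        ((1 - 2 * β) * y ^ (-(2 * β)) * eulerIntegral α β (2 - α - β) (fun _ => 1) x y x₀ y₀ -
          (2 - α - β) * y ^ (1 - 2 * β) *
            (2 * (y - y₀) * eulerIntegral α β (3 - α - β) (fun _ => 1) x y x₀ y₀ +
              4 * y₀ * eulerIntegral α β (3 - α - β) Prod.snd x y x₀ y₀)) := by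
  have hev : (fun t => q4 α β x t x₀ y₀) =ᶠ[𝓝 y] fun t =>
      q4Const α β * (x₀ ^ (1 - 2 * α) * y₀ ^ (1 - 2 * β)) * x ^ (1 - 2 * α) *
        (t ^ (1 - 2 * β) * eulerIntegral α β (2 - α - β) (fun _ => 1) x t x₀ y₀) := by
    filter_upwards [lt_mem_nhds hy, (continuous_rSq_snd x x₀ y₀).continuousAt.eventually
      (lt_mem_nhds hR)] with t ht hRt
    rw [q4_eq_eulerIntegral hx ht.le hx₀ hy₀ hRt]
    ring
  rw [hev.deriv_eq]
  have h1 := hasDerivAt_eulerIntegral_snd (e := 2 - α - β) hα hβ hx hy hx₀ hy₀ hR (by linarith)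
  have h2 := Real.hasDerivAt_rpow_const (p := 1 - 2 * β) (Or.inl hy.ne')
  refine ((h2.fun_mul h1).const_mul _).deriv.trans ?_
  rw [show 2 - α - β + 1 = 3 - α - β by ring, show 1 - 2 * β - 1 = -(2 * β) by ring]
  ring

end Derivative

/-! ### Pointwise bound for the weighted normal derivative. -/

section PointwiseBound

variable {α β x y x₀ y₀ : ℝ}

theorem eulerIntegral_nonneg (hx : 0 ≤ x) (hy : 0 ≤ y) (hx₀ : 0 ≤ x₀) (hy₀ : 0 ≤ y₀)
    (hR : 0 < rSq x y x₀ y₀) {e : ℝ} {c : ℝ × ℝ → ℝ} (hc : ∀ p ∈ unitSquare, 0 ≤ c p) :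
    0 ≤ eulerIntegral α β e c x y x₀ y₀ :=
  setIntegral_nonneg measurableSet_unitSquare fun p hp =>
    mul_nonneg (betaWeight₂_nonneg _ _ hp) (mul_nonneg (hc p hp) (Real.rpow_nonneg (hR.le.trans
      (le_eulerDenom (mul_nonneg hx hx₀) (mul_nonneg hy hy₀) hp)) _))

/-- `t t₀ ^ (1 - 2 a)` is controlled by `R + t t₀`, which dominates both `t²` and `t₀²`. -/
theorem mul_rpow_le_add_rpow {a t t₀ R : ℝ} (ha : a ≤ 1 / 2) (ht₀ : 0 ≤ t₀)
    (hR : (t - t₀) ^ 2 ≤ R) : t * t₀ ^ (1 - 2 * a) ≤ (4 * (R + t * t₀)) ^ (1 - a) := by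
  set S := 4 * (R + t * t₀) with hS
  have h1 : t ^ 2 ≤ S := by rw [hS]; nlinarith [sq_nonneg (t - 2 * t₀)]
  have h2 : t₀ ^ 2 ≤ S := by rw [hS]; nlinarith [sq_nonneg (t₀ - 2 * t)]
  have hS0 : 0 ≤ S := (sq_nonneg t).trans h1
  have h3 : t ≤ Real.sqrt S := Real.le_sqrt_of_sq_le h1
  have h4 : t₀ ≤ Real.sqrt S := Real.le_sqrt_of_sq_le h2
  calc t * t₀ ^ (1 - 2 * a) ≤ Real.sqrt S * Real.sqrt S ^ (1 - 2 * a) := by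
        refine mul_le_mul h3 (Real.rpow_le_rpow ht₀ h4 (by linarith)) (by positivity)
          (by positivity)
    _ = S ^ (1 - a) := by
        rw [Real.sqrt_eq_rpow, ← Real.rpow_mul hS0]
        rcases hS0.eq_or_lt with h | h
        · rw [← h, Real.zero_rpow (by norm_num : (1 / 2 : ℝ) ≠ 0),
            Real.zero_rpow (by linarith : 0 < 1 - a).ne', zero_mul]
        · rw [← Real.rpow_add h]; congr 1; ring

/-- The right side is what cancels the decay of the two Euler integrals in `R + x x₀` and `R + y
y₀`. -/
theorem weight_mul_le {a b t t₀ u u₀ R : ℝ} (ha : a ≤ 1 / 2) (hb : b ≤ 1 / 2) (ht : 0 ≤ t)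
    (ht₀ : 0 ≤ t₀) (hu : 0 ≤ u) (hu₀ : 0 ≤ u₀) (hR : (t - t₀) ^ 2 ≤ R) (hR' : (u - u₀) ^ 2 ≤ R) :
    t₀ ^ (1 - 2 * a) * u₀ ^ (1 - 2 * b) * (t * u) ≤
      4 ^ (1 - a) * 4 ^ (1 - b) * ((R + t * t₀) ^ (1 - a) * (R + u * u₀) ^ (1 - b)) := by
  have hR0 : 0 ≤ R := (sq_nonneg _).trans hR
  have h1 := mul_rpow_le_add_rpow ha ht₀ hR
  have h2 := mul_rpow_le_add_rpow hb hu₀ hR'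
  rw [Real.mul_rpow (by norm_num) (by positivity)] at h1 h2
  calc _ = (t * t₀ ^ (1 - 2 * a)) * (u * u₀ ^ (1 - 2 * b)) := by ring
    _ ≤ _ := mul_le_mul h1 h2 (by positivity) (by positivity)
    _ = _ := by ring

theorem exists_weight_mul_eulerIntegral_succ_le (hα : 0 ≤ α) (hα' : α < 1 / 2) (hβ : 0 ≤ β)
    (hβ' : β < 1 / 2) :
    ∃ C, 0 ≤ C ∧ ∀ x y x₀ y₀ : ℝ, 0 < x → 0 < y → 0 ≤ x₀ → 0 ≤ y₀ → 0 < rSq x y x₀ y₀ →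
      x₀ ^ (1 - 2 * α) * y₀ ^ (1 - 2 * β) * (x * y) *
        eulerIntegral α β (3 - α - β) (fun _ => 1) x y x₀ y₀ ≤ C * (rSq x y x₀ y₀)⁻¹ := by
  obtain ⟨C, hC, h⟩ := exists_integral_eulerDenom_succ_le hα (by linarith : α < 1) hβ
    (by linarith : β < 1)
  refine ⟨4 ^ (1 - α) * 4 ^ (1 - β) * C, by positivity, fun x y x₀ y₀ hx hy hx₀ hy₀ hR => ?_⟩
  set R := rSq x y x₀ y₀ with hRdef
  have hA := mul_nonneg hx.le hx₀
  have hB := mul_nonneg hy.le hy₀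
  have h1 := weight_mul_le (R := R) hα'.le hβ'.le hx.le hx₀ hy.le hy₀
    (by rw [hRdef, rSq]; nlinarith [sq_nonneg (y - y₀)])
    (by rw [hRdef, rSq]; nlinarith [sq_nonneg (x - x₀)])
  have h2 := h R _ _ hR hA hB
  have hJ : eulerIntegral α β (3 - α - β) (fun _ => 1) x y x₀ y₀ =
      ∫ p in unitSquare, betaWeight₂ α β p * eulerDenom R (x * x₀) (y * y₀) p ^ (-(3 - α - β)) := by
    simp only [eulerIntegral, one_mul, hRdef]
  have hS : 0 < R + x * x₀ := by positivity
  have hT : 0 < R + y * y₀ := by positivity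
  rw [← hJ] at h2
  refine (mul_le_mul h1 h2 (eulerIntegral_nonneg hx.le hy.le hx₀ hy₀ hR (by simp))
    (by positivity)).trans_eq ?_
  rw [Real.rpow_neg hS.le, Real.rpow_neg hT.le]
  have := (Real.rpow_pos_of_pos hS (1 - α)).ne'
  have := (Real.rpow_pos_of_pos hT (1 - β)).ne'
  field_simp

/-- After cancellation the powers `(R + x x₀)^(1/8) (R + y y₀)^(1/8)` survive. They grow like
`R^(1/4)` at most, because `x` and `y` are bounded by `M`, so the bound stays uniform for distant
`(x₀, y₀)`. -/
theorem exists_weight_mul_eulerIntegral_le (hα' : α < 1 / 2) (hβ' : β < 1 / 2) (M : ℝ) :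
    ∃ C, 0 ≤ C ∧ ∀ x y x₀ y₀ : ℝ, 0 < x → 0 < y → 0 ≤ x₀ → 0 ≤ y₀ → x ≤ M → y ≤ M →
      0 < rSq x y x₀ y₀ →
      x₀ ^ (1 - 2 * α) * y₀ ^ (1 - 2 * β) * (x * y) *
        eulerIntegral α β (2 - α - β) (fun _ => 1) x y x₀ y₀ ≤
      C * (1 + rSq x y x₀ y₀ ^ (-(1 / 4) : ℝ)) := by
  obtain ⟨C, hC, h⟩ := exists_integral_eulerDenom_le hα' hβ'
  -- The two summands come from subadditivity of the fourth root applied to `2 R + 2 M²`.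
  set D : ℝ := 2 ^ (1 / 4 : ℝ) + (2 * M ^ 2) ^ (1 / 4 : ℝ) with hD
  have hD0 : 0 ≤ D := by positivity
  refine ⟨4 ^ (1 - α) * 4 ^ (1 - β) * C * D, by positivity,
    fun x y x₀ y₀ hx hy hx₀ hy₀ hxM hyM hR => ?_⟩
  set R := rSq x y x₀ y₀ with hRdef
  have hA := mul_nonneg hx.le hx₀
  have hB := mul_nonneg hy.le hy₀
  have r1 : (x - x₀) ^ 2 ≤ R := by rw [hRdef, rSq]; nlinarith [sq_nonneg (y - y₀)]
  have r2 : (y - y₀) ^ 2 ≤ R := by rw [hRdef, rSq]; nlinarith [sq_nonneg (x - x₀)]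
  have h1 := weight_mul_le (R := R) hα'.le hβ'.le hx.le hx₀ hy.le hy₀ r1 r2
  have h2 := h R _ _ hR hA hB
  have hI : eulerIntegral α β (2 - α - β) (fun _ => 1) x y x₀ y₀ =
      ∫ p in unitSquare, betaWeight₂ α β p * eulerDenom R (x * x₀) (y * y₀) p ^ (-(2 - α - β)) := by
    simp only [eulerIntegral, one_mul, hRdef]
  have hS : 0 < R + x * x₀ := by positivity
  have hT : 0 < R + y * y₀ := by positivity
  have upper : ∀ {t t₀ : ℝ}, 0 < t → t ≤ M → (t - t₀) ^ 2 ≤ R →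
      R + t * t₀ ≤ 2 * (R + M ^ 2) := by
    intro t t₀ ht htM hr
    have : t ^ 2 ≤ M ^ 2 := pow_le_pow_left₀ ht.le htM 2
    nlinarith [sq_nonneg (t + (t - t₀))]
  have hQ : 0 < 2 * (R + M ^ 2) := by positivity
  have h3 : R ^ (-(1 / 4) : ℝ) * ((R + x * x₀) ^ (1 / 8 : ℝ) * (R + y * y₀) ^ (1 / 8 : ℝ)) ≤
      D * (1 + R ^ (-(1 / 4) : ℝ)) := by
    have i1 : (R + x * x₀) ^ (1 / 8 : ℝ) * (R + y * y₀) ^ (1 / 8 : ℝ) ≤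
        (2 * (R + M ^ 2)) ^ (1 / 4 : ℝ) := by
      rw [show (1 / 4 : ℝ) = 1 / 8 + 1 / 8 by norm_num, Real.rpow_add hQ]
      exact mul_le_mul (Real.rpow_le_rpow hS.le (upper hx hxM r1) (by norm_num))
        (Real.rpow_le_rpow hT.le (upper hy hyM r2) (by norm_num)) (by positivity) (by positivity)
    have i2 : (2 * (R + M ^ 2)) ^ (1 / 4 : ℝ) ≤
        2 ^ (1 / 4 : ℝ) * R ^ (1 / 4 : ℝ) + (2 * M ^ 2) ^ (1 / 4 : ℝ) := by
      rw [mul_add, ← Real.mul_rpow (by norm_num) hR.le]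
      exact Real.rpow_add_le_add_rpow (by positivity) (by positivity) (by norm_num) (by norm_num)
    have i3 : R ^ (-(1 / 4) : ℝ) * R ^ (1 / 4 : ℝ) = 1 := by
      rw [← Real.rpow_add hR]; norm_num
    have i4 : 0 ≤ R ^ (-(1 / 4) : ℝ) := by positivity
    have i5 : (0 : ℝ) ≤ 2 ^ (1 / 4 : ℝ) := by positivity
    have i6 : 0 ≤ (2 * M ^ 2) ^ (1 / 4 : ℝ) := by positivity
    calc _ ≤ R ^ (-(1 / 4) : ℝ) *
          (2 ^ (1 / 4 : ℝ) * R ^ (1 / 4 : ℝ) + (2 * M ^ 2) ^ (1 / 4 : ℝ)) :=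
          mul_le_mul_of_nonneg_left (i1.trans i2) i4
      _ = 2 ^ (1 / 4 : ℝ) * (R ^ (-(1 / 4) : ℝ) * R ^ (1 / 4 : ℝ)) +
          (2 * M ^ 2) ^ (1 / 4 : ℝ) * R ^ (-(1 / 4) : ℝ) := by ring
      _ ≤ _ := by rw [i3, hD]; nlinarith [mul_nonneg i5 i4]
  have cancel : ∀ {S a : ℝ}, 0 < S → S ^ (1 - a) * S ^ (-(1 - a - 1 / 8)) = S ^ (1 / 8 : ℝ) := by
    intro S a hS
    rw [← Real.rpow_add hS]; congr 1; ring
  rw [← hI] at h2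
  calc _ ≤ 4 ^ (1 - α) * 4 ^ (1 - β) * ((R + x * x₀) ^ (1 - α) * (R + y * y₀) ^ (1 - β)) *
        (C * (R ^ (-(1 / 4) : ℝ) * ((R + x * x₀) ^ (-(1 - α - 1 / 8)) *
          (R + y * y₀) ^ (-(1 - β - 1 / 8))))) :=
        mul_le_mul h1 h2 (eulerIntegral_nonneg hx.le hy.le hx₀ hy₀ hR (by simp)) (by positivity)
    _ = 4 ^ (1 - α) * 4 ^ (1 - β) * C * (R ^ (-(1 / 4) : ℝ) *
        (((R + x * x₀) ^ (1 - α) * (R + x * x₀) ^ (-(1 - α - 1 / 8))) *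
          ((R + y * y₀) ^ (1 - β) * (R + y * y₀) ^ (-(1 - β - 1 / 8))))) := by ring
    _ ≤ 4 ^ (1 - α) * 4 ^ (1 - β) * C * (D * (1 + R ^ (-(1 / 4) : ℝ))) := by
        rw [cancel hS, cancel hT]
        exact mul_le_mul_of_nonneg_left h3 (by positivity)
    _ = _ := by ring

/-- The weight `u` pays for one power of the denominator, since `u (R + x x₀) ≤ D`. So this part of
the derivative is no more singular than the undifferentiated integral. -/
theorem eulerIntegral_fst_le (hα : α < 1) (hβ : β < 1) (hx : 0 ≤ x) (hy : 0 ≤ y) (hx₀ : 0 ≤ x₀)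
    (hy₀ : 0 ≤ y₀) (hR : 0 < rSq x y x₀ y₀) :
    x * x₀ * eulerIntegral α β (3 - α - β) Prod.fst x y x₀ y₀ ≤
      eulerIntegral α β (2 - α - β) (fun _ => 1) x y x₀ y₀ := by
  have hA := mul_nonneg hx hx₀
  have hB := mul_nonneg hy hy₀
  have hS : 0 < rSq x y x₀ y₀ + x * x₀ := by positivity
  have h := integral_weighted_eulerDenom_succ_le hα hβ hR hA hB hS measurable_fst
    (fun p hp => hp.1.1.le) (fun p hp => hp.1.2.le) fun p hp =>
      (mul_add_le_add_mul hR.le hp.1.2.le).trans (add_mul_fst_le_eulerDenom hA hB hp)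
  have hU := eulerIntegral_nonneg (α := α) (β := β) (e := 3 - α - β) (c := Prod.fst)
    hx hy hx₀ hy₀ hR fun p hp => hp.1.1.le
  simp only [eulerIntegral, one_mul] at hU ⊢
  rw [inv_mul_eq_div, le_div_iff₀ hS] at h
  nlinarith [mul_nonneg hU hR.le]

theorem eulerIntegral_snd_le (hα : α < 1) (hβ : β < 1) (hx : 0 ≤ x) (hy : 0 ≤ y) (hx₀ : 0 ≤ x₀)
    (hy₀ : 0 ≤ y₀) (hR : 0 < rSq x y x₀ y₀) :
    y * y₀ * eulerIntegral α β (3 - α - β) Prod.snd x y x₀ y₀ ≤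
      eulerIntegral α β (2 - α - β) (fun _ => 1) x y x₀ y₀ := by
  have hA := mul_nonneg hx hx₀
  have hB := mul_nonneg hy hy₀
  have hS : 0 < rSq x y x₀ y₀ + y * y₀ := by positivity
  have h := integral_weighted_eulerDenom_succ_le hα hβ hR hA hB hS measurable_snd
    (fun p hp => hp.2.1.le) (fun p hp => hp.2.2.le) fun p hp =>
      (mul_add_le_add_mul hR.le hp.2.2.le).trans (add_mul_snd_le_eulerDenom hA hB hp)
  have hU := eulerIntegral_nonneg (α := α) (β := β) (e := 3 - α - β) (c := Prod.snd)
    hx hy hx₀ hy₀ hR fun p hp => hp.2.1.le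
  simp only [eulerIntegral, one_mul] at hU ⊢
  rw [inv_mul_eq_div, le_div_iff₀ hS] at h
  nlinarith [mul_nonneg hU hR.le]

/-- The weight clears the boundary powers of `x` and `y`. The vector `(n, -m)` is the normal, and
grouping isolates the double layer numerator `n (x - x₀) - m (y - y₀)`. -/
theorem weighted_normal_deriv_q4_eq (hα : α < 1) (hβ : β < 1) (hx : 0 < x)
    (hy : 0 < y) (hx₀ : 0 ≤ x₀) (hy₀ : 0 ≤ y₀) (hR : 0 < rSq x y x₀ y₀) (m n : ℝ) :
    x ^ (2 * α) * y ^ (2 * β) * (n * deriv (fun t => q4 α β t y x₀ y₀) x -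
        m * deriv (fun t => q4 α β x t x₀ y₀) y) =
      q4Const α β * (x₀ ^ (1 - 2 * α) * y₀ ^ (1 - 2 * β)) *
        (((1 - 2 * α) * (y * n) - (1 - 2 * β) * (x * m)) *
            eulerIntegral α β (2 - α - β) (fun _ => 1) x y x₀ y₀ -
          (2 - α - β) * (x * y) *
            (2 * (n * (x - x₀) - m * (y - y₀)) *
                eulerIntegral α β (3 - α - β) (fun _ => 1) x y x₀ y₀ +
              4 * x₀ * n * eulerIntegral α β (3 - α - β) Prod.fst x y x₀ y₀ -
              4 * y₀ * m * eulerIntegral α β (3 - α - β) Prod.snd x y x₀ y₀)) := by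
  rw [deriv_q4_fst hα hβ hx hy.le hx₀ hy₀ hR, deriv_q4_snd hα hβ hx.le hy hx₀ hy₀ hR]
  have c : ∀ {t : ℝ} (a : ℝ), 0 < t → t ^ a ≠ 0 := fun a ht => (Real.rpow_pos_of_pos ht a).ne'
  have := c (2 * α) hx
  have := c (2 * β) hy
  rw [Real.rpow_sub hx, Real.rpow_sub hy, Real.rpow_one, Real.rpow_one, Real.rpow_neg hx.le,
    Real.rpow_neg hy.le]
  field_simp
  ring

/-- The weighted normal derivative is bounded by the kernel of the logarithmic double layer
potential up to a weakly singular term. Here `(m, n)` is the tangent vector. -/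
theorem exists_weighted_normal_deriv_q4_le (hα : 0 ≤ α) (hα' : α < 1 / 2) (hβ : 0 ≤ β)
    (hβ' : β < 1 / 2) (M : ℝ) {L : ℝ} (hL : 0 ≤ L) :
    ∃ C, 0 ≤ C ∧ ∀ x y x₀ y₀ m n : ℝ, 0 < x → 0 < y → 0 ≤ x₀ → 0 ≤ y₀ → x ≤ M → y ≤ M →
      |m| ≤ L * y → |n| ≤ L * x → 0 < rSq x y x₀ y₀ →
      x ^ (2 * α) * y ^ (2 * β) * |n * deriv (fun t => q4 α β t y x₀ y₀) x -
        m * deriv (fun t => q4 α β x t x₀ y₀) y| ≤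
      C * (|n * (x - x₀) - m * (y - y₀)| * (rSq x y x₀ y₀)⁻¹ +
        (1 + rSq x y x₀ y₀ ^ (-(1 / 4) : ℝ))) := by
  obtain ⟨C₁, hC₁, h₁⟩ := exists_weight_mul_eulerIntegral_succ_le hα hα' hβ hβ'
  obtain ⟨C₂, hC₂, h₂⟩ := exists_weight_mul_eulerIntegral_le hα' hβ' M
  -- With `2 - α - β ≤ 2`, the normal term contributes `2 · 2`; the remaining terms contribute `2 L`
  -- and `2 · (4 L + 4 L)`.
  refine ⟨|q4Const α β| * (4 * C₁ + 18 * L * C₂), by positivity,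
    fun x y x₀ y₀ m n hx hy hx₀ hy₀ hxM hyM hm hn hR => ?_⟩
  have hα1 : α < 1 := by linarith
  have hβ1 : β < 1 := by linarith
  have hw : 0 ≤ x ^ (2 * α) * y ^ (2 * β) := by positivity
  rw [← abs_of_nonneg hw, ← abs_mul, weighted_normal_deriv_q4_eq hα1 hβ1 hx hy
    hx₀ hy₀ hR m n]
  have b₁ := h₁ x y x₀ y₀ hx hy hx₀ hy₀ hR
  have b₂ := h₂ x y x₀ y₀ hx hy hx₀ hy₀ hxM hyM hR
  have b₃ := eulerIntegral_fst_le hα1 hβ1 hx.le hy.le hx₀ hy₀ hR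
  have b₄ := eulerIntegral_snd_le hα1 hβ1 hx.le hy.le hx₀ hy₀ hR
  have n₁ := eulerIntegral_nonneg (α := α) (β := β) (e := 2 - α - β) (c := fun _ => 1)
    hx.le hy.le hx₀ hy₀ hR (by simp)
  have n₂ := eulerIntegral_nonneg (α := α) (β := β) (e := 3 - α - β) (c := fun _ => 1)
    hx.le hy.le hx₀ hy₀ hR (by simp)
  have n₃ := eulerIntegral_nonneg (α := α) (β := β) (e := 3 - α - β) (c := Prod.fst)
    hx.le hy.le hx₀ hy₀ hR fun p hp => hp.1.1.le
  have n₄ := eulerIntegral_nonneg (α := α) (β := β) (e := 3 - α - β) (c := Prod.snd)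
    hx.le hy.le hx₀ hy₀ hR fun p hp => hp.2.1.le
  set I := eulerIntegral α β (2 - α - β) (fun _ => 1) x y x₀ y₀
  set J := eulerIntegral α β (3 - α - β) (fun _ => 1) x y x₀ y₀
  set U := eulerIntegral α β (3 - α - β) Prod.fst x y x₀ y₀
  set V := eulerIntegral α β (3 - α - β) Prod.snd x y x₀ y₀
  set N := n * (x - x₀) - m * (y - y₀)
  set W := x₀ ^ (1 - 2 * α) * y₀ ^ (1 - 2 * β) with hWdef
  set R := rSq x y x₀ y₀
  have hW : 0 ≤ W := by positivity
  have hxy : 0 < x * y := mul_pos hx hy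
  rw [abs_mul, abs_mul, abs_of_nonneg hW, mul_assoc, mul_assoc |q4Const α β|]
  refine mul_le_mul_of_nonneg_left ?_ (abs_nonneg _)
  -- The tangent bounds restore the full factor `x y` here; without it `I` could not be controlled
  -- near the axes.
  have t1 : |((1 - 2 * α) * (y * n) - (1 - 2 * β) * (x * m)) * I| ≤ 2 * L * (x * y) * I := by
    rw [abs_mul, abs_of_nonneg n₁]
    refine mul_le_mul_of_nonneg_right ?_ n₁
    have a1 : |(1 - 2 * α) * (y * n)| ≤ 1 * (y * (L * x)) := by
      rw [abs_mul, abs_mul, abs_of_pos hy]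
      exact mul_le_mul (by rw [abs_le]; constructor <;> linarith) (by gcongr) (by positivity)
        zero_le_one
    have a2 : |(1 - 2 * β) * (x * m)| ≤ 1 * (x * (L * y)) := by
      rw [abs_mul, abs_mul, abs_of_pos hx]
      exact mul_le_mul (by rw [abs_le]; constructor <;> linarith) (by gcongr) (by positivity)
        zero_le_one
    exact (abs_sub _ _).trans (by linarith)
  have t2 : |4 * x₀ * n * U| ≤ 4 * L * I := by
    rw [abs_mul, abs_mul, abs_of_nonneg n₃, abs_of_nonneg (by positivity : 0 ≤ 4 * x₀)]
    calc 4 * x₀ * |n| * U ≤ 4 * x₀ * (L * x) * U := by gcongr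
      _ = 4 * L * (x * x₀ * U) := by ring
      _ ≤ _ := by gcongr
  have t3 : |4 * y₀ * m * V| ≤ 4 * L * I := by
    rw [abs_mul, abs_mul, abs_of_nonneg n₄, abs_of_nonneg (by positivity : 0 ≤ 4 * y₀)]
    calc 4 * y₀ * |m| * V ≤ 4 * y₀ * (L * y) * V := by gcongr
      _ = 4 * L * (y * y₀ * V) := by ring
      _ ≤ _ := by gcongr
  have t4 : |2 * N * J| = 2 * |N| * J := by
    rw [abs_mul, abs_mul, abs_of_nonneg n₂, abs_of_pos (by norm_num : (0 : ℝ) < 2)]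
  have t5 : |2 * N * J + 4 * x₀ * n * U - 4 * y₀ * m * V| ≤ 2 * |N| * J + 8 * L * I :=
    (abs_sub _ _).trans (by linarith [abs_add_le (2 * N * J) (4 * x₀ * n * U)])
  have t6 : |(2 - α - β) * (x * y) * (2 * N * J + 4 * x₀ * n * U - 4 * y₀ * m * V)| ≤
      2 * (x * y) * (2 * |N| * J + 8 * L * I) := by
    rw [abs_mul, abs_of_nonneg (mul_nonneg (by linarith : 0 ≤ 2 - α - β) hxy.le)]
    gcongr
    linarith
  calc W * |((1 - 2 * α) * (y * n) - (1 - 2 * β) * (x * m)) * I -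
        (2 - α - β) * (x * y) * (2 * N * J + 4 * x₀ * n * U - 4 * y₀ * m * V)|
      ≤ W * (2 * L * (x * y) * I + 2 * (x * y) * (2 * |N| * J + 8 * L * I)) :=
        mul_le_mul_of_nonneg_left ((abs_sub _ _).trans (add_le_add t1 t6)) hW
    _ = 4 * |N| * (W * (x * y) * J) + 18 * L * (W * (x * y) * I) := by ring
    _ ≤ 4 * |N| * (C₁ * R⁻¹) + 18 * L * (C₂ * (1 + R ^ (-(1 / 4) : ℝ))) := by gcongr
    _ ≤ _ := by
      have p1 : 0 ≤ |N| * R⁻¹ := by positivity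
      have p2 : 0 ≤ 1 + R ^ (-(1 / 4) : ℝ) := by positivity
      nlinarith [mul_nonneg hC₁ p2, mul_nonneg (mul_nonneg hL hC₂) p1]

end PointwiseBound

/-! ### Geometry of the curve and the one-dimensional model integrals. -/

section Arc

variable {l : ℝ} {f : ℝ → ℝ}

theorem hasDerivWithinAt_dds (hf : ContDiffOn ℝ 2 f (Icc 0 l)) {s : ℝ} (hs : s ∈ Icc 0 l) :
    HasDerivWithinAt f (dds l f s) (Icc 0 l) s :=
  (hf.differentiableOn (by norm_num) s hs).hasDerivWithinAt

theorem contDiffOn_dds (hl : 0 < l) (hf : ContDiffOn ℝ 2 f (Icc 0 l)) :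
    ContDiffOn ℝ 1 (dds l f) (Icc 0 l) :=
  hf.derivWithin (uniqueDiffOn_Icc hl) (by norm_num)

theorem exists_abs_taylor_le (hl : 0 < l) (hf : ContDiffOn ℝ 2 f (Icc 0 l)) :
    ∃ K, 0 ≤ K ∧ ∀ s ∈ Icc 0 l, ∀ t ∈ Icc 0 l,
      |f t - f s - dds l f s * (t - s)| ≤ K * (t - s) ^ 2 := by
  have h1 := contDiffOn_dds hl hf
  have h2 : ContinuousOn (derivWithin (dds l f) (Icc 0 l)) (Icc 0 l) :=
    h1.continuousOn_derivWithin (uniqueDiffOn_Icc hl) le_rfl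
  obtain ⟨K, hK⟩ := isCompact_Icc.exists_bound_of_continuousOn h2
  have hK0 : 0 ≤ K := (norm_nonneg _).trans (hK 0 ⟨le_rfl, hl.le⟩)
  refine ⟨K, hK0, fun s hs t ht => ?_⟩
  have hsub : uIcc s t ⊆ Icc 0 l := uIcc_subset_Icc hs ht
  have hlip : ∀ τ ∈ uIcc s t, ‖dds l f τ - dds l f s‖ ≤ K * |t - s| := by
    intro τ hτ
    refine ((convex_Icc 0 l).norm_image_sub_le_of_norm_derivWithin_le
      (h1.differentiableOn one_ne_zero) hK hs (hsub hτ)).trans ?_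
    gcongr
    exact abs_sub_left_of_mem_uIcc hτ
  have hd : ∀ τ ∈ uIcc s t, HasDerivWithinAt (fun τ => f τ - dds l f s * τ)
      (dds l f τ - dds l f s) (uIcc s t) τ := fun τ hτ => by
    have := ((hasDerivWithinAt_dds hf (hsub hτ)).mono hsub).sub
      ((hasDerivWithinAt_id τ (uIcc s t)).const_mul (dds l f s))
    rw [mul_one] at this
    exact this
  have := (convex_uIcc s t).norm_image_sub_le_of_norm_hasDerivWithin_le hd hlip
    left_mem_uIcc right_mem_uIcc
  rw [Real.norm_eq_abs, Real.norm_eq_abs, mul_assoc, ← sq, sq_abs] at this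
  rwa [show f t - f s - dds l f s * (t - s) = f t - dds l f s * t - (f s - dds l f s * s) by ring]

variable {a b : ℝ} {x y : ℝ → ℝ}

namespace IsAdmissibleCurve

theorem nonneg (hΓ : IsAdmissibleCurve a b l x y) {s : ℝ} (hs : s ∈ Icc 0 l) :
    0 ≤ x s ∧ 0 ≤ y s := by
  rcases hs.1.eq_or_lt with h | h
  · rw [← h, hΓ.start_eq.1, hΓ.start_eq.2]; exact ⟨le_rfl, hΓ.b_pos.le⟩
  rcases hs.2.eq_or_lt with h' | h'
  · rw [h', hΓ.end_eq.1, hΓ.end_eq.2]; exact ⟨hΓ.a_pos.le, le_rfl⟩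
  exact (hΓ.quadrant s ⟨h, h'⟩).imp le_of_lt le_of_lt

theorem exists_le (hΓ : IsAdmissibleCurve a b l x y) :
    ∃ M, 0 ≤ M ∧ ∀ s ∈ Icc 0 l, x s ≤ M ∧ y s ≤ M := by
  obtain ⟨M₁, h₁⟩ := isCompact_Icc.exists_bound_of_continuousOn hΓ.contDiff_x.continuousOn
  obtain ⟨M₂, h₂⟩ := isCompact_Icc.exists_bound_of_continuousOn hΓ.contDiff_y.continuousOn
  refine ⟨max M₁ M₂, ((norm_nonneg _).trans (h₁ 0 ⟨le_rfl, hΓ.l_pos.le⟩)).trans (le_max_left _ _),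
    fun s hs => ⟨?_, ?_⟩⟩
  · exact (le_abs_self _).trans ((h₁ s hs).trans (le_max_left _ _))
  · exact (le_abs_self _).trans ((h₂ s hs).trans (le_max_right _ _))

theorem abs_dds_le_one (hΓ : IsAdmissibleCurve a b l x y) {s : ℝ} (hs : s ∈ Icc 0 l) :
    |dds l x s| ≤ 1 ∧ |dds l y s| ≤ 1 := by
  have h := hΓ.arcLength s hs
  exact ⟨(sq_le_one_iff_abs_le_one _).1 (by nlinarith [sq_nonneg (dds l y s)]),
    (sq_le_one_iff_abs_le_one _).1 (by nlinarith [sq_nonneg (dds l x s)])⟩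

/-- The endpoint conditions give a linear bound along the whole curve. -/
theorem exists_abs_dds_le (hΓ : IsAdmissibleCurve a b l x y) :
    ∃ L, 0 ≤ L ∧ ∀ s ∈ Icc 0 l, |dds l x s| ≤ L * y s ∧ |dds l y s| ≤ L * x s := by
  obtain ⟨C, ε, δ, hε, -, hδ, h⟩ := hΓ.endpoints
  obtain ⟨M, hM0, hM⟩ := hΓ.exists_le
  have hsub : Icc δ (l - δ) ⊆ Ioo 0 l := fun s hs => ⟨hδ.trans_le hs.1, by linarith [hs.2]⟩
  have hpos : ∃ m, 0 < m ∧ ∀ s ∈ Icc δ (l - δ), m ≤ x s ∧ m ≤ y s := by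
    rcases (Icc δ (l - δ)).eq_empty_or_nonempty with he | hne
    · exact ⟨1, one_pos, by simp [he]⟩
    have hc := (hΓ.contDiff_x.continuousOn.mono (hsub.trans Ioo_subset_Icc_self)).inf
      (hΓ.contDiff_y.continuousOn.mono (hsub.trans Ioo_subset_Icc_self))
    obtain ⟨s₁, hs₁, hmin⟩ := isCompact_Icc.exists_isMinOn hne hc
    refine ⟨min (x s₁) (y s₁), lt_min (hΓ.quadrant s₁ (hsub hs₁)).1 (hΓ.quadrant s₁ (hsub hs₁)).2,
      fun s hs => le_min_iff.1 (hmin hs)⟩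
  obtain ⟨m, hm, hmle⟩ := hpos
  -- Near the ends `t^(1+ε) ≤ M^ε t`; in the middle `t ≥ m`, and unit speed gives `1 ≤ m⁻¹ t`.
  refine ⟨|C| * M ^ ε + m⁻¹, by positivity, fun s hs => ?_⟩
  have hnn := hΓ.nonneg hs
  have power : ∀ {t : ℝ}, 0 ≤ t → t ≤ M → C * t ^ (1 + ε) ≤ (|C| * M ^ ε + m⁻¹) * t := by
    intro t ht htM
    have h1 : t ^ ε ≤ M ^ ε := Real.rpow_le_rpow ht htM hε.le
    rw [Real.rpow_one_add' ht (by linarith : 0 < 1 + ε).ne']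
    have h2 : 0 ≤ t * t ^ ε := by positivity
    calc C * (t * t ^ ε) ≤ |C| * (t * M ^ ε) :=
          mul_le_mul (le_abs_self C) (by gcongr) h2 (abs_nonneg C)
      _ ≤ _ := by have : 0 ≤ m⁻¹ * t := by positivity
                  linarith
  by_cases hcase : s < δ ∨ l - δ < s
  · have := h s hs hcase
    exact ⟨this.1.trans (power hnn.2 (hM s hs).2), this.2.trans (power hnn.1 (hM s hs).1)⟩
  · rw [not_or, not_lt, not_lt] at hcase
    have hms := hmle s hcase
    have lin : ∀ {t : ℝ}, m ≤ t → 1 ≤ (|C| * M ^ ε + m⁻¹) * t := by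
      intro t ht
      have h1 : 1 ≤ m⁻¹ * t := by rw [inv_mul_eq_div]; exact (one_le_div hm).2 ht
      have h2 : 0 ≤ |C| * M ^ ε * t := mul_nonneg (by positivity) (hm.le.trans ht)
      linarith
    have h1 := hΓ.abs_dds_le_one hs
    exact ⟨h1.1.trans (lin hms.2), h1.2.trans (lin hms.1)⟩

/-- The chord-arc inequality. -/
theorem exists_chord_arc (hΓ : IsAdmissibleCurve a b l x y) :
    ∃ c, 0 < c ∧ ∀ s ∈ Icc 0 l, ∀ t ∈ Icc 0 l, c * (t - s) ^ 2 ≤ rSq (x t) (y t) (x s) (y s) := by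
  have hl := hΓ.l_pos
  obtain ⟨K₁, hK₁, h₁⟩ := exists_abs_taylor_le hl hΓ.contDiff_x
  obtain ⟨K₂, hK₂, h₂⟩ := exists_abs_taylor_le hl hΓ.contDiff_y
  -- Near the diagonal the linear part gives `(t - s)² / 2`, and this `δ` keeps the Taylor error
  -- below half of that. Away from it, compactness and simplicity of the curve give a positive
  -- minimum.
  set δ : ℝ := (4 * (K₁ ^ 2 + K₂ ^ 2 + 1))⁻¹ with hδ
  have hδ0 : 0 < δ := by positivity
  have near : ∀ s ∈ Icc 0 l, ∀ t ∈ Icc 0 l, (t - s) ^ 2 ≤ δ →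
      1 / 4 * (t - s) ^ 2 ≤ rSq (x t) (y t) (x s) (y s) := by
    intro s hs t ht hst
    have e₁ := sq_le_sq' (abs_le.1 (h₁ s hs t ht)).1 (abs_le.1 (h₁ s hs t ht)).2
    have e₂ := sq_le_sq' (abs_le.1 (h₂ s hs t ht)).1 (abs_le.1 (h₂ s hs t ht)).2
    have half : ∀ u v : ℝ, v ^ 2 / 2 - (u - v) ^ 2 ≤ u ^ 2 := fun u v => by
      nlinarith [sq_nonneg (2 * u - v)]
    have i₁ := half (x t - x s) (dds l x s * (t - s))
    have i₂ := half (y t - y s) (dds l y s * (t - s))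
    have i₃ : (K₁ ^ 2 + K₂ ^ 2) * (t - s) ^ 2 ≤ 1 / 4 := by
      calc (K₁ ^ 2 + K₂ ^ 2) * (t - s) ^ 2 ≤ (K₁ ^ 2 + K₂ ^ 2 + 1) * δ := by
            exact mul_le_mul (by linarith) hst (sq_nonneg _) (by positivity)
        _ = 1 / 4 := by rw [hδ]; field_simp
    have i₄ := mul_le_mul_of_nonneg_right i₃ (sq_nonneg (t - s))
    have i₅ : (dds l x s * (t - s)) ^ 2 + (dds l y s * (t - s)) ^ 2 = (t - s) ^ 2 := by
      rw [mul_pow, mul_pow, ← add_mul, hΓ.arcLength s hs, one_mul]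
    rw [rSq]
    nlinarith
  set S : Set (ℝ × ℝ) := (Icc 0 l ×ˢ Icc 0 l) ∩ {p | δ ≤ (p.2 - p.1) ^ 2} with hS
  have hScomp : IsCompact S := (isCompact_Icc.prod isCompact_Icc).inter_right
    (isClosed_le continuous_const (by fun_prop))
  have far : ∃ m, 0 < m ∧ ∀ p ∈ S, m ≤ rSq (x p.2) (y p.2) (x p.1) (y p.1) := by
    rcases S.eq_empty_or_nonempty with he | hne
    · exact ⟨1, one_pos, by simp [he]⟩
    have m1 : MapsTo Prod.fst S (Icc 0 l) := fun p hp => hp.1.1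
    have m2 : MapsTo Prod.snd S (Icc 0 l) := fun p hp => hp.1.2
    have cx := hΓ.contDiff_x.continuousOn
    have cy := hΓ.contDiff_y.continuousOn
    have hc : ContinuousOn (fun p : ℝ × ℝ => rSq (x p.2) (y p.2) (x p.1) (y p.1)) S :=
      (((cx.comp continuousOn_snd m2).sub (cx.comp continuousOn_fst m1)).pow 2).add
        (((cy.comp continuousOn_snd m2).sub (cy.comp continuousOn_fst m1)).pow 2)
    obtain ⟨p₁, hp₁, hmin⟩ := hScomp.exists_isMinOn hne hc
    refine ⟨_, ?_, fun p hp => hmin hp⟩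
    refine lt_of_le_of_ne (add_nonneg (sq_nonneg _) (sq_nonneg _)) fun h0 => ?_
    have hx : x p₁.2 = x p₁.1 := by
      have := h0.symm; simp only [rSq] at this
      nlinarith [sq_nonneg (x p₁.2 - x p₁.1), sq_nonneg (y p₁.2 - y p₁.1)]
    have hy : y p₁.2 = y p₁.1 := by
      have := h0.symm; simp only [rSq] at this
      nlinarith [sq_nonneg (x p₁.2 - x p₁.1), sq_nonneg (y p₁.2 - y p₁.1)]
    have heq := hΓ.simple hp₁.1.2 hp₁.1.1 (Prod.ext hx hy)
    have := hp₁.2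
    rw [mem_ofPred_eq, heq, sub_self] at this
    norm_num at this
    linarith
  obtain ⟨m, hm, hfar⟩ := far
  refine ⟨min (1 / 4) (m / l ^ 2), by positivity, fun s hs t ht => ?_⟩
  rcases le_total ((t - s) ^ 2) δ with h | h
  · exact (mul_le_mul_of_nonneg_right (min_le_left _ _) (sq_nonneg _)).trans (near s hs t ht h)
  · have h1 : (t - s) ^ 2 ≤ l ^ 2 :=
      sq_le_sq' (by linarith [hs.2, ht.1]) (by linarith [hs.1, ht.2])
    calc min (1 / 4) (m / l ^ 2) * (t - s) ^ 2 ≤ m / l ^ 2 * l ^ 2 := by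
          gcongr; exact min_le_right _ _
      _ = m := by field_simp
      _ ≤ _ := hfar (s, t) ⟨⟨hs, ht⟩, h⟩

/-- Seen from any point of the plane, the curve has a base parameter `s₀` (that of a nearest point)
such that the kernel of the logarithmic double layer potential is bounded by an approximate
identity centred at `s₀`. -/
theorem exists_double_layer_le (hΓ : IsAdmissibleCurve a b l x y) :
    ∃ κ K, 0 < κ ∧ 0 ≤ K ∧ ∀ x₀ y₀ : ℝ, ∃ s₀ ∈ Icc 0 l, ∃ d, 0 ≤ d ∧ ∀ s ∈ Icc 0 l,
      κ ^ 2 * (s - s₀) ^ 2 ≤ rSq (x s) (y s) x₀ y₀ ∧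
      (s ≠ s₀ → |dds l y s * (x s - x₀) - dds l x s * (y s - y₀)| * (rSq (x s) (y s) x₀ y₀)⁻¹ ≤
        K + 2 * (d / (d ^ 2 + κ ^ 2 * (s - s₀) ^ 2))) := by
  have hl := hΓ.l_pos
  obtain ⟨K₁, hK₁, h₁⟩ := exists_abs_taylor_le hl hΓ.contDiff_x
  obtain ⟨K₂, hK₂, h₂⟩ := exists_abs_taylor_le hl hΓ.contDiff_y
  obtain ⟨c, hc, hchord⟩ := hΓ.exists_chord_arc
  have hκ2 : (Real.sqrt (c / 4)) ^ 2 = c / 4 := Real.sq_sqrt (by positivity)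
  refine ⟨Real.sqrt (c / 4), (K₁ + K₂) * (c / 4)⁻¹, by positivity, by positivity,
    fun x₀ y₀ => ?_⟩
  have hcont : ContinuousOn (fun s => rSq (x s) (y s) x₀ y₀) (Icc 0 l) :=
    ((hΓ.contDiff_x.continuousOn.sub continuousOn_const).pow 2).add
      ((hΓ.contDiff_y.continuousOn.sub continuousOn_const).pow 2)
  obtain ⟨s₀, hs₀, hmin⟩ := isCompact_Icc.exists_isMinOn (nonempty_Icc.2 hl.le) hcont
  have hd2 : (Real.sqrt (rSq (x s₀) (y s₀) x₀ y₀)) ^ 2 = rSq (x s₀) (y s₀) x₀ y₀ :=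
    Real.sq_sqrt (add_nonneg (sq_nonneg _) (sq_nonneg _))
  refine ⟨s₀, hs₀, Real.sqrt (rSq (x s₀) (y s₀) x₀ y₀), Real.sqrt_nonneg _, fun s hs => ?_⟩
  set d := Real.sqrt (rSq (x s₀) (y s₀) x₀ y₀) with hd
  have hd0 : 0 ≤ d := Real.sqrt_nonneg _
  set R := rSq (x s) (y s) x₀ y₀ with hR
  have hdR : d ^ 2 ≤ R := hd2.le.trans (hmin hs)
  rw [hκ2]
  -- Triangle inequality through `(x₀, y₀)`: the chord from `s₀` to `s` has squared length at most
  -- `2 R + 2 d² ≤ 4 R`.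
  have hlow : c / 4 * (s - s₀) ^ 2 ≤ R := by
    have h3 := hchord s₀ hs₀ s hs
    have h4 : rSq (x s) (y s) (x s₀) (y s₀) ≤ 2 * R + 2 * d ^ 2 := by
      rw [hd2, hR]; simp only [rSq]
      nlinarith [sq_nonneg ((x s - x₀) + (x s₀ - x₀)), sq_nonneg ((y s - y₀) + (y s₀ - y₀))]
    linarith
  refine ⟨hlow, fun hne => ?_⟩
  have hsq : 0 < (s - s₀) ^ 2 := by have := sub_ne_zero.2 hne; positivity
  have hq : 0 < c / 4 * (s - s₀) ^ 2 := by positivity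
  have hR0 : 0 < R := hq.trans_le hlow
  -- The path from `(x₀, y₀)` passes through the nearest point. Expanding at `s` rather than `s₀`
  -- makes the linear part tangent at `s`, so the normal kills it; the remaining vector has length
  -- `d`.
  have hN : |dds l y s * (x s - x₀) - dds l x s * (y s - y₀)| ≤ (K₁ + K₂) * (s - s₀) ^ 2 + d := by
    have e₁ := h₁ s hs s₀ hs₀
    have e₂ := h₂ s hs s₀ hs₀
    obtain ⟨u₁, u₂⟩ := hΓ.abs_dds_le_one hs
    have e₃ : |dds l y s * (x s₀ - x₀) - dds l x s * (y s₀ - y₀)| ≤ d := by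
      refine Real.abs_le_sqrt ?_
      have := hΓ.arcLength s hs
      calc _ ≤ (dds l x s ^ 2 + dds l y s ^ 2) * rSq (x s₀) (y s₀) x₀ y₀ := by
            rw [rSq]
            nlinarith [sq_nonneg (dds l x s * (x s₀ - x₀) + dds l y s * (y s₀ - y₀))]
        _ = _ := by rw [this, one_mul]
    have e₄ : dds l y s * (x s - x₀) - dds l x s * (y s - y₀) =
        dds l x s * (y s₀ - y s - dds l y s * (s₀ - s)) -
          dds l y s * (x s₀ - x s - dds l x s * (s₀ - s)) +
          (dds l y s * (x s₀ - x₀) - dds l x s * (y s₀ - y₀)) := by ring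
    have e₅ : |dds l x s * (y s₀ - y s - dds l y s * (s₀ - s))| ≤ K₂ * (s - s₀) ^ 2 := by
      rw [abs_mul, show (s - s₀) ^ 2 = (s₀ - s) ^ 2 by ring]
      exact (mul_le_of_le_one_left (abs_nonneg _) u₁).trans e₂
    have e₆ : |dds l y s * (x s₀ - x s - dds l x s * (s₀ - s))| ≤ K₁ * (s - s₀) ^ 2 := by
      rw [abs_mul, show (s - s₀) ^ 2 = (s₀ - s) ^ 2 by ring]
      exact (mul_le_of_le_one_left (abs_nonneg _) u₂).trans e₁
    rw [e₄]
    refine (abs_add_le _ _).trans (add_le_add ((abs_sub _ _).trans ?_) e₃)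
    linarith
  calc _ ≤ ((K₁ + K₂) * (s - s₀) ^ 2 + d) * R⁻¹ := by gcongr
    _ = (K₁ + K₂) * (s - s₀) ^ 2 * R⁻¹ + d * R⁻¹ := by ring
    -- In the second term `R` is bounded below by the mean of its two lower bounds, whence the
    -- factor 2.
    _ ≤ (K₁ + K₂) * (s - s₀) ^ 2 * (c / 4 * (s - s₀) ^ 2)⁻¹ +
        d * ((d ^ 2 + c / 4 * (s - s₀) ^ 2) / 2)⁻¹ := by
      gcongr
      linarith
    _ = _ := by
      rw [mul_inv, inv_div]
      have : d ^ 2 + c / 4 * (s - s₀) ^ 2 ≠ 0 := by positivity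
      field_simp

end IsAdmissibleCurve

/-- The antiderivative `κ⁻¹ arctan (κ (s - s₀) / d)` varies by at most `π / κ`, independently of
`d`, so the bound persists as the point approaches the curve. At `d = 0` the kernel vanishes. -/
theorem poisson_kernel_integral_le {κ d : ℝ} (hκ : 0 < κ) (hd : 0 ≤ d) (s₀ : ℝ) (p q : ℝ) :
    IntervalIntegrable (fun s => d / (d ^ 2 + κ ^ 2 * (s - s₀) ^ 2)) volume p q ∧
      ∫ s in p..q, d / (d ^ 2 + κ ^ 2 * (s - s₀) ^ 2) ≤ Real.pi / κ := by
  rcases hd.eq_or_lt with h | h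
  · simp only [← h, zero_div]
    exact ⟨intervalIntegrable_const, by rw [intervalIntegral.integral_zero]; positivity⟩
  have hne : ∀ s : ℝ, d ^ 2 + κ ^ 2 * (s - s₀) ^ 2 ≠ 0 := fun s => by positivity
  have hcont : Continuous fun s => d / (d ^ 2 + κ ^ 2 * (s - s₀) ^ 2) :=
    Continuous.div continuous_const (by fun_prop) hne
  have hint := hcont.intervalIntegrable (μ := volume) p q
  refine ⟨hint, ?_⟩
  have hder : ∀ s ∈ uIcc p q, HasDerivAt (fun s => κ⁻¹ * Real.arctan (κ / d * (s - s₀)))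
      (d / (d ^ 2 + κ ^ 2 * (s - s₀) ^ 2)) s := fun s _ => by
    have h1 := ((((hasDerivAt_id s).sub_const s₀).const_mul (κ / d)).arctan).const_mul κ⁻¹
    refine h1.congr_deriv ?_
    have := hne s
    have : 1 + (κ / d * (s - s₀)) ^ 2 ≠ 0 := by positivity
    simp only [id]
    field_simp
  rw [intervalIntegral.integral_eq_sub_of_hasDerivAt hder hint, ← mul_sub,
    div_eq_inv_mul Real.pi]
  refine mul_le_mul_of_nonneg_left ?_ (inv_nonneg.2 hκ.le)
  linarith [Real.arctan_lt_pi_div_two (κ / d * (q - s₀)),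
    Real.neg_pi_div_two_lt_arctan (κ / d * (p - s₀))]

theorem intervalIntegrable_abs_rpow {r : ℝ} (hr : -1 < r) (p q : ℝ) :
    IntervalIntegrable (fun s : ℝ => |s| ^ r) volume p q := by
  have hpos : ∀ q : ℝ, 0 ≤ q → IntervalIntegrable (fun s : ℝ => |s| ^ r) volume 0 q := fun q hq =>
    (intervalIntegral.intervalIntegrable_rpow' hr).congr fun s hs => by
      rw [uIoc_of_le hq] at hs
      simp only [abs_of_pos hs.1]
  have hall : ∀ q : ℝ, IntervalIntegrable (fun s : ℝ => |s| ^ r) volume 0 q := fun q => by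
    rcases le_total 0 q with h | h
    · exact hpos q h
    · rw [IntervalIntegrable.iff_comp_neg]
      simpa using hpos (-q) (by linarith)
  exact (hall p).symm.trans (hall q)

/-- After translation the interval lies in `[-l, l]`, which removes the dependence on `s₀`. -/
theorem abs_sub_rpow_integral_le {r : ℝ} (hr : -1 < r) {s₀ : ℝ} (hs₀ : s₀ ∈ Icc 0 l) :
    IntervalIntegrable (fun s => |s - s₀| ^ r) volume 0 l ∧
      ∫ s in (0 : ℝ)..l, |s - s₀| ^ r ≤ ∫ s in -l..l, |s| ^ r := by
  have hl : 0 ≤ l := hs₀.1.trans hs₀.2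
  refine ⟨?_, ?_⟩
  · simpa using (intervalIntegrable_abs_rpow hr (0 - s₀) (l - s₀)).comp_sub_right s₀
  · rw [intervalIntegral.integral_comp_sub_right (fun s => |s| ^ r)]
    refine intervalIntegral.integral_mono_interval (by linarith [hs₀.2]) (by linarith [hs₀.2])
      (by linarith [hs₀.1]) (Eventually.of_forall fun s => by positivity)
      (intervalIntegrable_abs_rpow hr _ _)

end Arc

/-! ### Integration along the curve. -/

section Main

variable {α β a b l : ℝ} {x y : ℝ → ℝ}

theorem aemeasurable_comp₂ {μ : Measure ℝ} (hx : AEMeasurable x μ) (hy : AEMeasurable y μ)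
    {G : ℝ → ℝ → ℝ} (hG : Measurable fun P : ℝ × ℝ => G P.1 P.2) :
    AEMeasurable (fun s => G (x s) (y s)) μ :=
  hG.comp_aemeasurable (hx.prodMk hy)

/-- Measurability is read off from the closed form, which replaces the derivatives except possibly
at `s₀`, a null set. -/
theorem aemeasurable_weighted_normalDerivQ4 (hα : α < 1) (hβ : β < 1)
    (hΓ : IsAdmissibleCurve a b l x y) {x₀ y₀ s₀ : ℝ} (hx₀ : 0 ≤ x₀) (hy₀ : 0 ≤ y₀)
    (hR : ∀ s ∈ Ioo 0 l, s ≠ s₀ → 0 < rSq (x s) (y s) x₀ y₀) :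
    AEMeasurable (fun s => x s ^ (2 * α) * y s ^ (2 * β) * |normalDerivQ4 α β l x y x₀ y₀ s|)
      (volume.restrict (Ioo 0 l)) := by
  set μ : Measure ℝ := volume.restrict (Ioo 0 l) with hμ
  have mono : μ ≤ volume.restrict (Icc 0 l) := Measure.restrict_mono Ioo_subset_Icc_self le_rfl
  have mx : AEMeasurable x μ :=
    (hΓ.contDiff_x.continuousOn.aemeasurable measurableSet_Icc).mono_measure mono
  have my : AEMeasurable y μ :=
    (hΓ.contDiff_y.continuousOn.aemeasurable measurableSet_Icc).mono_measure mono
  have mx' : AEMeasurable (dds l x) μ := ((contDiffOn_dds hΓ.l_pos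
    hΓ.contDiff_x).continuousOn.aemeasurable measurableSet_Icc).mono_measure mono
  have my' : AEMeasurable (dds l y) μ := ((contDiffOn_dds hΓ.l_pos
    hΓ.contDiff_y).continuousOn.aemeasurable measurableSet_Icc).mono_measure mono
  have mE : ∀ (e : ℝ) (c : ℝ × ℝ → ℝ), Measurable c → AEMeasurable
      (fun s => eulerIntegral α β e c (x s) (y s) x₀ y₀) μ :=
    fun e c hc => aemeasurable_comp₂ mx my (G := fun u v => eulerIntegral α β e c u v x₀ y₀)
      (measurable_eulerIntegral α β e hc x₀ y₀)
  have mI := mE (2 - α - β) (fun _ => 1) measurable_const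
  have mJ := mE (3 - α - β) (fun _ => 1) measurable_const
  have mU := mE (3 - α - β) Prod.fst measurable_fst
  have mV := mE (3 - α - β) Prod.snd measurable_snd
  have main : AEMeasurable (fun s => |q4Const α β * (x₀ ^ (1 - 2 * α) * y₀ ^ (1 - 2 * β)) *
        (((1 - 2 * α) * (y s * dds l y s) - (1 - 2 * β) * (x s * dds l x s)) *
            eulerIntegral α β (2 - α - β) (fun _ => 1) (x s) (y s) x₀ y₀ -
          (2 - α - β) * (x s * y s) *
            (2 * (dds l y s * (x s - x₀) - dds l x s * (y s - y₀)) *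
                eulerIntegral α β (3 - α - β) (fun _ => 1) (x s) (y s) x₀ y₀ +
              4 * x₀ * dds l y s * eulerIntegral α β (3 - α - β) Prod.fst (x s) (y s) x₀ y₀ -
              4 * y₀ * dds l x s * eulerIntegral α β (3 - α - β) Prod.snd (x s) (y s) x₀ y₀))|)
      μ := by
    refine AEMeasurable.abs (AEMeasurable.const_mul (AEMeasurable.sub (AEMeasurable.mul ?_ mI)
      (AEMeasurable.mul ?_ (AEMeasurable.sub (AEMeasurable.add (AEMeasurable.mul ?_ mJ)
        (AEMeasurable.mul ?_ mU)) (AEMeasurable.mul ?_ mV)))) _)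
    all_goals fun_prop
  refine main.congr ?_
  filter_upwards [ae_restrict_mem measurableSet_Ioo,
    ae_restrict_of_ae (compl_mem_ae_iff.2 (measure_singleton s₀))] with s hs hne
  obtain ⟨hxs, hys⟩ := hΓ.quadrant s hs
  rw [← weighted_normal_deriv_q4_eq hα hβ hxs hys hx₀ hy₀ (hR s hs hne), abs_mul,
    abs_of_nonneg (by positivity), normalDerivQ4]

/-- The double layer potential of the constant density is absolutely convergent and bounded. -/
theorem exists_integral_weighted_normalDerivQ4_le (hα : 0 ≤ α) (hα' : α < 1 / 2) (hβ : 0 ≤ β)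
    (hβ' : β < 1 / 2) (hΓ : IsAdmissibleCurve a b l x y) :
    ∃ C₁ : ℝ, ∀ x₀ y₀ : ℝ, 0 ≤ x₀ → 0 ≤ y₀ →
      IntervalIntegrable
        (fun s => x s ^ (2 * α) * y s ^ (2 * β) * |normalDerivQ4 α β l x y x₀ y₀ s|) volume 0 l ∧
      ∫ s in (0 : ℝ)..l, x s ^ (2 * α) * y s ^ (2 * β) * |normalDerivQ4 α β l x y x₀ y₀ s| ≤
        C₁ := by
  have hl := hΓ.l_pos
  obtain ⟨M, -, hM⟩ := hΓ.exists_le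
  obtain ⟨L, hL, hLb⟩ := hΓ.exists_abs_dds_le
  obtain ⟨C, hC, hbound⟩ := exists_weighted_normal_deriv_q4_le hα hα' hβ hβ' M hL
  obtain ⟨κ, K, hκ, hK, hker⟩ := hΓ.exists_double_layer_le
  -- Exponent of `|s - s₀|` obtained from `R^(-1/4)` and `R ≥ κ² (s - s₀)²`.
  set r : ℝ := -(1 / 2) with hr
  have hr1 : -1 < r := by norm_num [hr]
  refine ⟨C * ((K + 1) * l + 2 * (Real.pi / κ) + κ ^ r * ∫ s in -l..l, |s| ^ r),
    fun x₀ y₀ hx₀ hy₀ => ?_⟩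
  obtain ⟨s₀, hs₀, d, hd, hs⟩ := hker x₀ y₀
  have hR : ∀ s ∈ Ioo 0 l, s ≠ s₀ → 0 < rSq (x s) (y s) x₀ y₀ := fun s hsI hne => by
    have h0 := sub_ne_zero.2 hne
    exact lt_of_lt_of_le (by positivity) (hs s (Ioo_subset_Icc_self hsI)).1
  obtain ⟨i₁, I₁⟩ := poisson_kernel_integral_le hκ hd s₀ 0 l
  obtain ⟨i₂, I₂⟩ := abs_sub_rpow_integral_le hr1 hs₀
  set g : ℝ → ℝ := fun s => C * ((K + 1) + 2 * (d / (d ^ 2 + κ ^ 2 * (s - s₀) ^ 2)) +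
    κ ^ r * |s - s₀| ^ r) with hg
  have hgi : IntervalIntegrable g volume 0 l :=
    (((intervalIntegrable_const).add (i₁.const_mul 2)).add (i₂.const_mul _)).const_mul C
  -- The two ends, where a coordinate vanishes, and `s₀`, where the curve may meet `(x₀, y₀)`, form
  -- a null set.
  have hle : ∀ᵐ s ∂volume.restrict (Ioo 0 l),
      x s ^ (2 * α) * y s ^ (2 * β) * |normalDerivQ4 α β l x y x₀ y₀ s| ≤ g s := by
    filter_upwards [ae_restrict_mem measurableSet_Ioo,
      ae_restrict_of_ae (compl_mem_ae_iff.2 (measure_singleton s₀))] with s hsI hne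
    have hsI' := Ioo_subset_Icc_self hsI
    obtain ⟨hxs, hys⟩ := hΓ.quadrant s hsI
    have hRs := hR s hsI hne
    have h1 := hbound (x s) (y s) x₀ y₀ (dds l x s) (dds l y s) hxs hys hx₀ hy₀ (hM s hsI').1
      (hM s hsI').2 (hLb s hsI').1 (hLb s hsI').2 hRs
    have h2 := (hs s hsI').2 hne
    have h3 : rSq (x s) (y s) x₀ y₀ ^ (-(1 / 4) : ℝ) ≤ κ ^ r * |s - s₀| ^ r := by
      have h0 : 0 < |s - s₀| := abs_pos.2 (sub_ne_zero.2 hne)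
      have h4 : κ ^ 2 * (s - s₀) ^ 2 = (κ * |s - s₀|) ^ (2 : ℝ) := by
        rw [Real.rpow_two, mul_pow, sq_abs]
      rw [← Real.mul_rpow hκ.le h0.le, show r = 2 * (-(1 / 4)) by rw [hr]; norm_num,
        Real.rpow_mul (by positivity), ← h4]
      have h0' := sub_ne_zero.2 hne
      exact Real.rpow_le_rpow_of_nonpos (by positivity) (hs s hsI').1 (by norm_num)
    refine h1.trans (mul_le_mul_of_nonneg_left ?_ hC)
    linarith
  have hfi : IntervalIntegrable (fun s => x s ^ (2 * α) * y s ^ (2 * β) *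
      |normalDerivQ4 α β l x y x₀ y₀ s|) volume 0 l := by
    rw [intervalIntegrable_iff_integrableOn_Ioo_of_le hl.le] at hgi ⊢
    refine Integrable.mono' hgi (aemeasurable_weighted_normalDerivQ4 (by linarith) (by linarith)
      hΓ hx₀ hy₀ hR).aestronglyMeasurable ?_
    filter_upwards [hle, ae_restrict_mem measurableSet_Ioo] with s h hsI
    obtain ⟨hxs, hys⟩ := hΓ.quadrant s hsI
    rwa [Real.norm_of_nonneg (by positivity)]
  refine ⟨hfi, ?_⟩
  have hint : ∫ s in (0 : ℝ)..l, x s ^ (2 * α) * y s ^ (2 * β) *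
      |normalDerivQ4 α β l x y x₀ y₀ s| ≤ ∫ s in (0 : ℝ)..l, g s := by
    refine intervalIntegral.integral_mono_ae_restrict hl.le hfi hgi ?_
    rw [EventuallyLE, ← restrict_Ioo_eq_restrict_Icc]
    exact hle
  refine hint.trans ?_
  rw [hg, intervalIntegral.integral_const_mul, intervalIntegral.integral_add
    (intervalIntegrable_const.add (i₁.const_mul 2)) (i₂.const_mul _),
    intervalIntegral.integral_add intervalIntegrable_const (i₁.const_mul 2),
    intervalIntegral.integral_const_mul, intervalIntegral.integral_const_mul,
    intervalIntegral.integral_const, smul_eq_mul, sub_zero, mul_comm l]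
  gcongr

end Main

end FourthPotential

theorem mainTheorem4 (α β : ℝ) (hα : 0 < 2 * α ∧ 2 * α < 1) (hβ : 0 < 2 * β ∧ 2 * β < 1)
    (a b l : ℝ) (x y : ℝ → ℝ) (hΓ : FourthPotential.IsAdmissibleCurve a b l x y) :
    ∃ C₁ : ℝ, ∀ x₀ y₀ : ℝ, 0 ≤ x₀ → 0 ≤ y₀ →
      IntervalIntegrable
        (fun s => x s ^ (2 * α) * y s ^ (2 * β) *
          |FourthPotential.normalDerivQ4 α β l x y x₀ y₀ s|) MeasureTheory.volume 0 l ∧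
      ∫ s in (0 : ℝ)..l, x s ^ (2 * α) * y s ^ (2 * β) *
          |FourthPotential.normalDerivQ4 α β l x y x₀ y₀ s| ≤ C₁ := by
  exact FourthPotential.exists_integral_weighted_normalDerivQ4_le (by linarith) (by linarith)
    (by linarith) (by linarith) hΓ
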